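/- Let $q\ge 1$ and $n_1,\dots,n_q\ge 1$ be integers, let $A$ be a Noetherian integral domain with fraction field $K$, and let $A[\mathbf x]$ be the polynomial ring in the variables $x_{p,i}$ ($1\le p\le q$, $0\le i\le n_p$), with the $\mathbb N^q$-grading in which $x_{p,i}$ has multidegree the $p$-th basis vector. Order $\mathbb N^q$ componentwise; "for $\nu$ large enough" means for all $\nu\ge\nu_0$, for some $\nu_0\in\mathbb N^q$. Let $M=\bigoplus_{\nu\in\mathbb N^q}M_\nu$ be a finitely generated multigraded $A[\mathbf x]$-module that is projective as an $A$-module. Its Hilbert polynomial $H_M\in\mathbb Q[t_1,\dots,t_q]$ is the polynomial with $H_M(\nu)=\dim_K(M_\nu\otimes_A K)$ for $\nu$ large enough, and its relevant dimension is the total degree of $H_M$, or $-1$ if $H_M=0$. A multihomogeneous $g\in A[\mathbf x]$ is filter-regular for a multigraded module $L$ if, for $\nu$ large enough, the only $m\in L_\nu$ with $gm=0$ is $m=0$. A sequence $(f_0,\dots,f_r)$ is filter-regular for $M$ if each $f_i$ is filter-regular for $M/(f_0,\dots,f_{i-1})M$. Call a finitely generated $A$-module $N$ torsion if $\operatorname{Ann}_A(N)\ne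 0$. For such $N$ put $\operatorname{div}_A(N)=\sum_{\mathfrak p}\ell_{A_{\mathfrak p}}(N_{\mathfrak p})\,[\mathfrak p]$ in the free abelian group $\operatorname{Div}(A)$ on the primes of height $1$ of $A$; if $N$ is not torsion, put $\operatorname{div}_A(N)=0$. Let $r\ge -1$ be the relevant dimension of $M$, let $\mathbf f=(f_0,\dots,f_r)$ be a filter-regular sequence for $M$ (of length $r+1$), and let $N=M/(\mathbf f)M$. Then there is $\nu_0\in\mathbb N^q$ such that for every $\nu\ge\nu_0$: 1. $N_\nu$ is a torsion $A$-module (so that its divisor is not $0$ by convention); 2. $\operatorname{div}_A(N_\nu)=\operatorname{div}_A(N_{\nu_0})$; 3. $\operatorname{div}_A(N_\nu)\neq 0$ if and only if $\operatorname{Ann}_A(N_\nu)$ is contained in some prime of $A$ of height $1$. -/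

import Mathlib

namespace Multigraded

/-- The index set of the variables `x_{p,i}`, with `p = 1, …, q` and `i = 0, …, n_p`. -/
abbrev Vars {q : ℕ} (n : Fin q → ℕ) : Type := Σ p : Fin q, Fin (n p + 1)

/-- The polynomial ring `A[x]` in the variables `x_{p,i}`. -/
abbrev Poly {q : ℕ} (n : Fin q → ℕ) (A : Type*) [CommRing A] : Type _ :=
  MvPolynomial (Vars n) A

/-- The multidegree of `x_{p,i}` is the basis vector `e_p` of `ℕ^q`. -/
def varDegree {q : ℕ} (n : Fin q → ℕ) : Vars n → (Fin q → ℕ) := fun v => Pi.single v.1 1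

/-- The multihomogeneous component `A[x]_d`. -/
noncomputable def polyComponent {q : ℕ} (n : Fin q → ℕ) (A : Type*) [CommRing A]
    (d : Fin q → ℕ) : Submodule A (Poly n A) :=
  MvPolynomial.weightedHomogeneousSubmodule A (varDegree n) d

section Modules

variable {q : ℕ} (n : Fin q → ℕ) {A : Type*} [CommRing A] {M : Type*} [AddCommGroup M]
  [Module A M] [Module (Poly n A) M]

/-- The family `ℳ` makes `M` a multigraded `A[x]`-module: `M = ⨁ M_d` and
`A[x]_d M_e ⊆ M_{d + e}`. -/
structure IsGrading (ℳ : (Fin q → ℕ) → Submodule A M) : Prop where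
  isInternal : DirectSum.IsInternal ℳ
  smul_mem : ∀ (d e : Fin q → ℕ) (g : Poly n A) (m : M),
    g ∈ polyComponent n A d → m ∈ ℳ e → g • m ∈ ℳ (d + e)

/-- A multihomogeneous polynomial `g` is filter-regular for `M`: the multihomogeneous components
of `(0 :_M g)` of large multidegree vanish. -/
def IsFilterRegular (ℳ : (Fin q → ℕ) → Submodule A M) (g : Poly n A) : Prop :=
  (∃ d : Fin q → ℕ, g ∈ polyComponent n A d) ∧
    ∃ ν₀ : Fin q → ℕ, ∀ ν, ν₀ ≤ ν → ∀ m ∈ ℳ ν, g • m = 0 → m = 0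

variable [IsScalarTower A (Poly n A) M]

/-- The components `(M / N)_ν = M_ν / (N ∩ M_ν)`, realised as the image of `M_ν` in `M / N`. -/
noncomputable def quotientGrading (ℳ : (Fin q → ℕ) → Submodule A M) (N : Submodule (Poly n A) M) :
    (Fin q → ℕ) → Submodule A (M ⧸ N) :=
  fun ν => (ℳ ν).map (N.mkQ.restrictScalars A)

/-- `f_0, …, f_{s-1}` is a filter-regular sequence for `M`: each `f_i` is filter-regular for
`M / (f_0, …, f_{i-1}) M`. -/
def IsFilterRegularSeq (ℳ : (Fin q → ℕ) → Submodule A M) {s : ℕ} (f : Fin s → Poly n A) : Prop :=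
  ∀ i : Fin s, IsFilterRegular n
    (quotientGrading n ℳ (Ideal.span (f '' {j | j < i}) • (⊤ : Submodule (Poly n A) M))) (f i)

/-- The component `(M / (f) M)_ν`, an `A`-module. -/
noncomputable abbrev quotientComponent (ℳ : (Fin q → ℕ) → Submodule A M) {s : ℕ} (f : Fin s → Poly n A)
    (ν : Fin q → ℕ) :
    Submodule A (M ⧸ (Ideal.span (Set.range f) • (⊤ : Submodule (Poly n A) M))) :=
  quotientGrading n ℳ (Ideal.span (Set.range f) • (⊤ : Submodule (Poly n A) M)) ν

end Modules

section Hilbert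

variable {q : ℕ} {A : Type*} [CommRing A] {M : Type*} [AddCommGroup M] [Module A M]

/-- The generic rank `dim_K (K ⊗_A M)`, where `K` is the fraction field of the domain `A`. -/
noncomputable def genericRank (A : Type*) [CommRing A] [IsDomain A] (M : Type*) [AddCommGroup M]
    [Module A M] : ℕ :=
  Module.finrank (FractionRing A) (TensorProduct A (FractionRing A) M)

/-- `P` takes the value `rank_A (M_ν)` at every `ν` large enough. -/
def IsHilbertPolynomial [IsDomain A] (ℳ : (Fin q → ℕ) → Submodule A M)
    (P : MvPolynomial (Fin q) ℚ) : Prop :=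
  ∃ ν₀ : Fin q → ℕ, ∀ ν, ν₀ ≤ ν →
    (genericRank A (ℳ ν) : ℚ) = MvPolynomial.eval (fun p => (ν p : ℚ)) P

open Classical in
/-- The Hilbert polynomial `H_M`. It exists and is unique when `M` is a finitely generated
multigraded module over `A[x]`, with `A` a Noetherian domain. -/
noncomputable def hilbertPolynomial [IsDomain A] (ℳ : (Fin q → ℕ) → Submodule A M) :
    MvPolynomial (Fin q) ℚ :=
  if h : ∃ P, IsHilbertPolynomial ℳ P then h.choose else 0

open Classical in
/-- The relevant dimension: the total degree of `H_M`, or `-1` if `H_M = 0`. -/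
noncomputable def relevantDim [IsDomain A] (ℳ : (Fin q → ℕ) → Submodule A M) : ℤ :=
  if hilbertPolynomial ℳ = 0 then -1 else ((hilbertPolynomial ℳ).totalDegree : ℤ)

end Hilbert

section Divisors

/-- A finitely generated module with nonzero annihilator. -/
def IsTorsionModule (A : Type*) [CommRing A] (N : Type*) [AddCommGroup N] [Module A N] : Prop :=
  Module.Finite A N ∧ Module.annihilator A N ≠ ⊥

/-- The primes of height one. -/
abbrev HeightOnePrime (A : Type*) [CommRing A] : Type _ :=
  {p : PrimeSpectrum A // p.asIdeal.height = 1}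

/-- `Div(A)`: the free abelian group on the primes of height one. -/
abbrev DivisorGroup (A : Type*) [CommRing A] : Type _ := HeightOnePrime A →₀ ℤ

/-- The length of `N_p` over `A_p`. -/
noncomputable def localLength (A : Type*) [CommRing A] (N : Type*) [AddCommGroup N] [Module A N]
    (p : PrimeSpectrum A) : ℕ∞ :=
  Module.length (Localization.AtPrime p.asIdeal) (LocalizedModule p.asIdeal.primeCompl N)

variable {A : Type*} [CommRing A] {N : Type*} [AddCommGroup N] [Module A N]

theorem annihilator_le_of_localLength_ne_zero {p : PrimeSpectrum A}
    (h : localLength A N p ≠ 0) : Module.annihilator A N ≤ p.asIdeal := by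
  intro a ha
  by_contra hap
  apply h
  rw [localLength, Module.length_eq_zero_iff]
  refine LocalizedModule.subsingleton_iff.mpr fun m => ⟨a, hap, ?_⟩
  exact Module.mem_annihilator.mp ha m

theorem finite_heightOnePrime_of_ne_bot [IsDomain A] [IsNoetherianRing A] {I : Ideal A}
    (hI : I ≠ ⊥) : {p : HeightOnePrime A | I ≤ p.1.asIdeal}.Finite := by
  have hfin := Ideal.finite_minimalPrimes_of_isNoetherianRing A I
  refine Set.Finite.of_finite_image (f := fun p : HeightOnePrime A => p.1.asIdeal)
    (hfin.subset ?_) ?_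
  · rintro _ ⟨p, hp, rfl⟩
    refine ⟨⟨p.1.isPrime, hp⟩, ?_⟩
    rintro J ⟨hJ, hIJ⟩ hJp
    by_contra hcon
    have hlt : J < p.1.asIdeal := lt_of_le_not_ge hJp hcon
    have hbot : (⊥ : Ideal A) < J := lt_of_lt_of_le (bot_lt_iff_ne_bot.mpr hI) hIJ
    have hpr : p.1.asIdeal.IsPrime := p.1.isPrime
    have hb : (⊥ : Ideal A).IsPrime := Ideal.isPrime_bot
    have h1 := Ideal.height_add_one_le_of_lt_of_isPrime hbot
    have h2 := Ideal.height_add_one_le_of_lt_of_isPrime hlt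
    rw [p.2] at h2
    have h3 : (1 : ℕ∞) ≤ J.height := le_trans (by simp) h1
    have h4 : (1 : ℕ∞) + 1 ≤ 1 := le_trans (by gcongr) h2
    exact absurd h4 (by decide)
  · intro p _ p' _ h
    exact Subtype.ext (PrimeSpectrum.ext h)

open Classical in
/-- The divisor `∑ ℓ(N_p) [p]` of a torsion module, the sum being over the primes of height one;
the divisor of a module that is not torsion is `0`. For a torsion module over a Noetherian domain
these lengths are finite, and nonzero for finitely many `p` only. -/
noncomputable def divisor (A : Type*) [CommRing A] [IsDomain A] [IsNoetherianRing A] (N : Type*)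
    [AddCommGroup N] [Module A N] : DivisorGroup A :=
  if h : IsTorsionModule A N then
    Finsupp.ofSupportFinite (fun p : HeightOnePrime A => ((localLength A N p.1).toNat : ℤ))
      ((finite_heightOnePrime_of_ne_bot h.2).subset fun p hp =>
        annihilator_le_of_localLength_ne_zero fun h0 => hp (by simp [h0]))
  else 0

end Divisors

end Multigraded

/-! Let V_i = (f_0, …, f_{i-1})M. Along the quotients M/V_i two functions of ν are followed: the
generic rank of the component of degree ν and, at each height-one prime p, the length at p of its
torsion. The invariant `DimLT` with parameter k asks that the first be eventually polynomial of
degree < k and the second eventually polynomial of degree ≤ k. For V = 0 it holds with k = r + 1,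
because a projective M has no torsion. For k = 0 the rank vanishes, so the whole component is
torsion, and its length at p is eventually constant.

The heart is `DimLT.sup_shiftMul`: a filter-regular f lowers k by one. Put V' = V + fM and let G, G'
be the preimages in M of the torsion of M/V, M/V'. In large degrees f is injective on M/V and on
M/G. Hence the rank of M/V' and the length of (G + fM)/V' ≅ G/(V + fG) are differences of the
earlier functions, and their degrees drop. There remains the new torsion G'/(G + fM). If c ≠ 0 kills
G'/V', multiplication by c embeds it into (G + fM)/(G + cfM), which is M/(G + cM) up to the shift by
deg f. Its length at p is at most rank(M/G) · ℓ(A_p/c), hence bounded by a function of the degree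
allowed. As the length of the new torsion is itself eventually polynomial (`exists_evPol_hilb`, a
multigraded Hilbert–Serre theorem), the bound controls its degree (`EvPol.of_le`).

The threshold can be taken independent of p: a single nonzero element kills the torsion of M/(f)M in
all degrees, and only finitely many height-one primes contain it. The criterion for a nonzero
divisor holds because the support of a finite module is the closed set of its annihilator. -/

open Filter
set_option linter.unusedSectionVars false

namespace Multigraded

/-! ### Functions on ℕ^q that are eventually polynomial, described by finite differences -/

section PolynomialFunctions

variable {ι : Type*} [Fintype ι] [DecidableEq ι]

/-- The forward difference in the direction of the `p`-th basis vector. -/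
def diff (p : ι) (F : (ι → ℕ) → ℚ) : (ι → ℕ) → ℚ := fun ν => F (ν + Pi.single p 1) - F ν

theorem single_succ (p : ι) (m : ℕ) :
    (Pi.single p (m + 1) : ι → ℕ) = Pi.single p m + Pi.single p 1 :=
  Pi.single_add (f := fun _ => ℕ) p m 1

/-- `F` is a polynomial function of degree `< k`: all differences of order `k` vanish. -/
def IsPolyFun : ℕ → ((ι → ℕ) → ℚ) → Prop
  | 0, F => ∀ ν, F ν = 0
  | k + 1, F => ∀ p, IsPolyFun k (diff p F)

/-- `F` agrees in large degrees with a polynomial function of degree `< k`. -/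
def EvPol : ℕ → ((ι → ℕ) → ℚ) → Prop
  | 0, F => ∀ᶠ ν in atTop, F ν = 0
  | k + 1, F => ∀ p, EvPol k (diff p F)

theorem tendsto_add_right_atTop (d : ι → ℕ) :
    Tendsto (fun ν : ι → ℕ => ν + d) atTop atTop :=
  tendsto_atTop_mono (fun _ => le_self_add) tendsto_id

theorem eventually_of_eventually_shift {P : (ι → ℕ) → Prop} (d : ι → ℕ)
    (h : ∀ᶠ ν in atTop, P (ν + d)) : ∀ᶠ ν in atTop, P ν := by
  obtain ⟨ν₀, h₀⟩ := eventually_atTop.1 h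
  filter_upwards [eventually_ge_atTop (ν₀ + d)] with ν hν
  have := h₀ (ν - d) (fun i => by have := hν i; simp only [Pi.add_apply, Pi.sub_apply] at *; omega)
  rwa [tsub_add_cancel_of_le (le_trans le_add_self hν)] at this

theorem EvPol.congr {k : ℕ} {F G : (ι → ℕ) → ℚ} (h : EvPol k F) (e : F =ᶠ[atTop] G) :
    EvPol k G := by
  induction k generalizing F G with
  | zero => filter_upwards [h, e] with ν h1 h2; rw [← h2, h1]
  | succ k ih =>
    intro p
    refine ih (h p) ?_
    filter_upwards [e, (tendsto_add_right_atTop (Pi.single p 1)).eventually e] with ν h1 h2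
    simp only [diff, h1, h2]

theorem EvPol.add {k : ℕ} {F G : (ι → ℕ) → ℚ} (hF : EvPol k F) (hG : EvPol k G) :
    EvPol k (fun ν => F ν + G ν) := by
  induction k generalizing F G with
  | zero => filter_upwards [hF, hG] with ν h1 h2; rw [h1, h2, add_zero]
  | succ k ih =>
    intro p
    exact (ih (hF p) (hG p)).congr (.of_forall fun ν => by simp only [diff]; ring)

theorem EvPol.const_mul {k : ℕ} {F : (ι → ℕ) → ℚ} (c : ℚ) (hF : EvPol k F) :
    EvPol k (fun ν => c * F ν) := by
  induction k generalizing F with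
  | zero => filter_upwards [hF] with ν h1; rw [h1, mul_zero]
  | succ k ih =>
    intro p
    exact (ih (hF p)).congr (.of_forall fun ν => by simp only [diff]; ring)

theorem EvPol.sub {k : ℕ} {F G : (ι → ℕ) → ℚ} (hF : EvPol k F) (hG : EvPol k G) :
    EvPol k (fun ν => F ν - G ν) :=
  (hF.add (hG.const_mul (-1))).congr (.of_forall fun ν => by ring)

theorem EvPol.shift {k : ℕ} {F : (ι → ℕ) → ℚ} (hF : EvPol k F) (d : ι → ℕ) :
    EvPol k (fun ν => F (ν + d)) := by
  induction k generalizing F with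
  | zero => exact (tendsto_add_right_atTop d).eventually hF
  | succ k ih =>
    intro p
    exact (ih (hF p)).congr (.of_forall fun ν => by simp only [diff, add_right_comm])

theorem EvPol.of_shift {k : ℕ} {F : (ι → ℕ) → ℚ} (d : ι → ℕ)
    (hF : EvPol k (fun ν => F (ν + d))) : EvPol k F := by
  induction k generalizing F with
  | zero => exact eventually_of_eventually_shift d hF
  | succ k ih =>
    intro p
    exact ih ((hF p).congr (.of_forall fun ν => by simp only [diff, add_right_comm]))

theorem EvPol.succ {k : ℕ} {F : (ι → ℕ) → ℚ} (hF : EvPol k F) : EvPol (k + 1) F := by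
  induction k generalizing F with
  | zero =>
    intro p
    change ∀ᶠ ν in atTop, diff p F ν = 0
    filter_upwards [hF, (tendsto_add_right_atTop (Pi.single p 1)).eventually hF] with ν h1 h2
    simp only [diff, h1, h2, sub_zero]
  | succ k ih => exact fun p => ih (hF p)

theorem EvPol.mono {k l : ℕ} {F : (ι → ℕ) → ℚ} (hF : EvPol k F) (h : k ≤ l) : EvPol l F := by
  induction l, h using Nat.le_induction with
  | base => exact hF
  | succ l _ ih => exact ih.succ

/-- The translation by `d` telescopes into unit steps. This is what lets an element of arbitrary
multidegree, and not only a variable, lower the degree. -/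
theorem EvPol.shift_sub {k : ℕ} {F : (ι → ℕ) → ℚ} (hF : EvPol (k + 1) F) (d : ι → ℕ) :
    EvPol k (fun ν => F (ν + d) - F ν) := by
  have key : ∀ (m : ℕ) (p : ι), EvPol k (fun ν => F (ν + Pi.single p m) - F ν) := by
    intro m p
    induction m with
    | zero =>
      have : EvPol k (fun _ : ι → ℕ => (0 : ℚ)) := EvPol.mono (k := 0) (by simp [EvPol]) (by simp)
      exact this.congr (.of_forall fun ν => by simp)
    | succ m ih =>
      refine (ih.add ((hF p).shift (Pi.single p m))).congr (.of_forall fun ν => ?_)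
      simp only [diff, single_succ p m, add_assoc]
      ring
  have key2 : ∀ s : Finset ι, EvPol k (fun ν => F (ν + ∑ p ∈ s, Pi.single p (d p)) - F ν) := by
    intro s
    induction s using Finset.induction_on with
    | empty =>
      have : EvPol k (fun _ : ι → ℕ => (0 : ℚ)) := EvPol.mono (k := 0) (by simp [EvPol]) (by simp)
      exact this.congr (.of_forall fun ν => by simp)
    | insert p s hp ih =>
      refine (ih.add ((key (d p) p).shift (∑ p ∈ s, Pi.single p (d p)))).congr
        (.of_forall fun ν => ?_)
      simp only [Finset.sum_insert hp]
      rw [add_comm (Pi.single _ _ : ι → ℕ), add_assoc]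
      ring
  have := key2 Finset.univ
  rwa [Finset.univ_sum_single] at this

theorem IsPolyFun.shift {k : ℕ} {F : (ι → ℕ) → ℚ} (hF : IsPolyFun k F) (d : ι → ℕ) :
    IsPolyFun k (fun ν => F (ν + d)) := by
  induction k generalizing F with
  | zero => exact fun ν => hF _
  | succ k ih =>
    intro p
    have : diff p (fun ν => F (ν + d)) = fun ν => diff p F (ν + d) := by
      ext ν; simp only [diff, add_right_comm]
    rw [this]
    exact ih (hF p)

/-- The thresholds of the finitely many directions are absorbed into one translation, by their sum.
-/
theorem EvPol.exists_isPolyFun {k : ℕ} {F : (ι → ℕ) → ℚ} (hF : EvPol k F) :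
    ∃ d, IsPolyFun k (fun ν => F (ν + d)) := by
  induction k generalizing F with
  | zero =>
    obtain ⟨d, hd⟩ := eventually_atTop.1 hF
    exact ⟨d, fun ν => hd _ le_add_self⟩
  | succ k ih =>
    choose d hd using fun p => ih (hF p)
    refine ⟨∑ p, d p, fun p => ?_⟩
    have := (hd p).shift (∑ p' ∈ Finset.univ.erase p, d p')
    have e : diff p (fun ν => F (ν + ∑ p, d p)) =
        fun ν => diff p F (ν + ∑ p' ∈ Finset.univ.erase p, d p' + d p) := by
      ext ν
      simp only [diff, add_assoc, Finset.sum_erase_add _ _ (Finset.mem_univ p)]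
      rw [add_comm (Pi.single p 1)]
    rw [e]; exact this

theorem EvPol.eventually_const {F : (ι → ℕ) → ℚ} (hF : EvPol 1 F) :
    ∃ ν₀, ∀ ν, ν₀ ≤ ν → F ν = F ν₀ := by
  obtain ⟨d, hd⟩ := hF.exists_isPolyFun
  have key : ∀ (m : ℕ) (p : ι) ν, F (ν + Pi.single p m + d) = F (ν + d) := by
    intro m p ν
    induction m with
    | zero => simp
    | succ m ih =>
      have := hd p (ν + Pi.single p m)
      simp only [diff] at this
      rw [← ih, single_succ, ← add_assoc]
      linarith
  refine ⟨d, fun ν hν => ?_⟩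
  have key2 : ∀ s : Finset ι, F (∑ p ∈ s, Pi.single p ((ν - d) p) + d) = F d := by
    intro s
    induction s using Finset.induction_on with
    | empty => simp
    | insert p s hp ih => rw [Finset.sum_insert hp, add_comm (Pi.single p _), key, ih]
  have := key2 Finset.univ
  rwa [Finset.univ_sum_single, tsub_add_cancel_of_le hν] at this

theorem induction_single {P : (ι → ℕ) → Prop} (h0 : P 0)
    (h1 : ∀ ν p, P ν → P (ν + Pi.single p 1)) (ν : ι → ℕ) : P ν := by
  induction hn : ∑ i, ν i generalizing ν with
  | zero =>
    have : ν = 0 := by ext i; exact (Finset.sum_eq_zero_iff.1 hn) i (Finset.mem_univ i)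
    rwa [this]
  | succ n ih =>
    obtain ⟨p, -, hp⟩ : ∃ p ∈ Finset.univ, ν p ≠ 0 := by
      by_contra! h
      rw [Finset.sum_eq_zero h] at hn
      omega
    have e : ν = (ν - Pi.single p 1) + Pi.single p 1 := by
      refine (tsub_add_cancel_of_le ?_).symm
      intro i
      rcases eq_or_ne i p with rfl | h
      · simp; omega
      · simp [h]
    rw [e]
    refine h1 _ _ (ih _ ?_)
    rw [e] at hn
    simp only [Pi.add_apply, Finset.sum_add_distrib, Finset.sum_pi_single', Finset.mem_univ,
      if_true] at hn
    have h2 : ∑ i, (Pi.single p 1 : ι → ℕ) i = 1 := by simp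
    omega

/-- The path from 0 to ν has ∑ ν_i unit steps, and each changes `F` by a difference that induction
bounds by a power one lower. -/
theorem IsPolyFun.exists_bound {k : ℕ} {F : (ι → ℕ) → ℚ} (hF : IsPolyFun (k + 1) F) :
    ∃ C : ℚ, 0 ≤ C ∧ ∀ ν, |F ν| ≤ C * (1 + ∑ i, (ν i : ℚ)) ^ k := by
  induction k generalizing F with
  | zero =>
    refine ⟨|F 0|, abs_nonneg _, fun ν => ?_⟩
    rw [pow_zero, mul_one]
    refine induction_single (P := fun ν => |F ν| ≤ |F 0|) le_rfl (fun ν p h => ?_) ν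
    have := hF p ν
    simp only [diff] at this
    rw [sub_eq_zero.1 this]
    exact h
  | succ k ih =>
    choose C hC0 hC using fun p => ih (hF p)
    have hS0 : 0 ≤ ∑ p, C p := Finset.sum_nonneg fun p _ => hC0 p
    refine ⟨|F 0| + ∑ p, C p, by positivity, fun ν => ?_⟩
    have key : |F ν| ≤ |F 0| + (∑ p, C p) * (∑ i, (ν i : ℚ)) * (1 + ∑ i, (ν i : ℚ)) ^ k := by
      refine induction_single (P := fun ν => |F ν| ≤ |F 0| + (∑ p, C p) * (∑ i, (ν i : ℚ)) *
        (1 + ∑ i, (ν i : ℚ)) ^ k) (by simp) (fun ν p h => ?_) ν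
      have h1 : |F (ν + Pi.single p 1)| ≤ |F ν| + |diff p F ν| := by
        have : F (ν + Pi.single p 1) = F ν + diff p F ν := by simp [diff]
        rw [this]
        exact abs_add_le _ _
      have hs : ∑ i, (((ν + Pi.single p 1 : ι → ℕ) i : ℕ) : ℚ) = ∑ i, (ν i : ℚ) + 1 := by
        have h2 : ∑ i, (Pi.single p 1 : ι → ℕ) i = 1 := by simp
        have : ∑ i, (ν + Pi.single p 1 : ι → ℕ) i = ∑ i, ν i + 1 := by
          simp only [Pi.add_apply, Finset.sum_add_distrib, h2]
        exact_mod_cast this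
      rw [hs]
      have hp : C p ≤ ∑ p, C p := Finset.single_le_sum (fun p _ => hC0 p) (Finset.mem_univ p)
      have hn : (0 : ℚ) ≤ ∑ i, (ν i : ℚ) := Finset.sum_nonneg fun i _ => by positivity
      have h6 := hC p ν
      generalize (∑ i, (ν i : ℚ)) = n at *
      have h3 : |diff p F ν| ≤ (∑ p, C p) * (1 + n) ^ k := by
        exact h6.trans (by gcongr)
      have h4 : (1 + n) ^ k ≤ (1 + (n + 1)) ^ k := by gcongr; linarith
      calc _ ≤ |F 0| + (∑ p, C p) * n * (1 + n) ^ k + (∑ p, C p) * (1 + n) ^ k := by linarith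
        _ = |F 0| + (∑ p, C p) * (n + 1) * (1 + n) ^ k := by ring
        _ ≤ _ := by gcongr
    have hn : (0 : ℚ) ≤ ∑ i, (ν i : ℚ) := Finset.sum_nonneg fun i _ => by positivity
    generalize (∑ i, (ν i : ℚ)) = n at *
    have h5 : 1 ≤ (1 + n) ^ (k + 1) := one_le_pow₀ (by linarith)
    calc _ ≤ _ := key
      _ ≤ |F 0| * (1 + n) ^ (k + 1) + (∑ p, C p) * (1 + n) * (1 + n) ^ k := by
        gcongr
        · exact le_mul_of_one_le_right (abs_nonneg _) h5
        · linarith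
      _ = _ := by ring

/-- Iterated differences with steps of length `t`. -/
def iterDiff (t : ℕ) : List ι → ((ι → ℕ) → ℚ) → ((ι → ℕ) → ℚ)
  | [], F => F
  | p :: l, F => iterDiff t l (fun ν => F (ν + Pi.single p t) - F ν)

theorem iterDiff_add (t : ℕ) (l : List ι) (F G : (ι → ℕ) → ℚ) (ν : ι → ℕ) :
    iterDiff t l (fun ν => F ν + G ν) ν = iterDiff t l F ν + iterDiff t l G ν := by
  induction l generalizing F G with
  | nil => rfl
  | cons p l ih =>
    simp only [iterDiff]
    rw [← ih]
    congr 1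
    ext ν
    ring

theorem iterDiff_shift (t : ℕ) (l : List ι) (F : (ι → ℕ) → ℚ) (d ν : ι → ℕ) :
    iterDiff t l (fun ν => F (ν + d)) ν = iterDiff t l F (ν + d) := by
  induction l generalizing F with
  | nil => rfl
  | cons p l ih =>
    simp only [iterDiff]
    rw [← ih]
    simp only [add_right_comm]

theorem isPolyFun_iff_iterDiff {k : ℕ} {F : (ι → ℕ) → ℚ} :
    IsPolyFun k F ↔ ∀ l : List ι, l.length = k → ∀ ν, iterDiff 1 l F ν = 0 := by
  induction k generalizing F with
  | zero =>
    refine ⟨fun h l hl ν => ?_, fun h ν => h [] rfl ν⟩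
    rw [List.length_eq_zero_iff.1 hl]
    exact h ν
  | succ k ih =>
    refine ⟨fun h l hl ν => ?_, fun h p => ih.2 fun l hl ν => h (p :: l) (by simp [hl]) ν⟩
    match l with
    | p :: l => exact ih.1 (h p) l (by simpa using hl) ν

theorem IsPolyFun.add {k : ℕ} {F G : (ι → ℕ) → ℚ} (hF : IsPolyFun k F) (hG : IsPolyFun k G) :
    IsPolyFun k (fun ν => F ν + G ν) := by
  rw [isPolyFun_iff_iterDiff] at *
  intro l hl ν
  rw [iterDiff_add, hF l hl, hG l hl, add_zero]

theorem IsPolyFun.iterDiff_shift_eq {k : ℕ} {F : (ι → ℕ) → ℚ} (hF : IsPolyFun (k + 1) F)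
    {l : List ι} (hl : l.length = k) (ν : ι → ℕ) (p : ι) (t : ℕ) :
    iterDiff 1 l F (ν + Pi.single p t) = iterDiff 1 l F ν := by
  induction t with
  | zero => simp
  | succ t ih =>
    have : iterDiff 1 l (diff p F) (ν + Pi.single p t) = 0 :=
      isPolyFun_iff_iterDiff.1 (hF p) l hl _
    have h2 := iterDiff_add 1 l F (diff p F) (ν + Pi.single p t)
    rw [this, add_zero, ih] at h2
    rw [← h2, single_succ, ← add_assoc, ← iterDiff_shift]
    simp [diff]

/-- A difference of top order is constant and additive in each of its `k` steps, so stretching every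
step by `t` multiplies it by t^k. -/
theorem IsPolyFun.iterDiff_eq {k : ℕ} {F : (ι → ℕ) → ℚ} (hF : IsPolyFun (k + 1) F)
    {l : List ι} (hl : l.length = k) (t : ℕ) (ν : ι → ℕ) :
    iterDiff t l F ν = (t : ℚ) ^ k * iterDiff 1 l F ν := by
  induction k generalizing F l with
  | zero =>
    rw [List.length_eq_zero_iff.1 hl]
    simp [iterDiff]
  | succ k ih =>
    match l with
    | p :: l =>
      have hl : l.length = k := by simpa using hl
      have key : ∀ t : ℕ, IsPolyFun (k + 1) (fun ν => F (ν + Pi.single p t) - F ν) ∧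
          iterDiff 1 l (fun ν => F (ν + Pi.single p t) - F ν) ν =
            t * iterDiff 1 l (diff p F) ν := by
        intro t
        induction t with
        | zero =>
          have h0 : iterDiff 1 l (fun _ => (0 : ℚ)) ν = 0 := by
            have := iterDiff_add 1 l (fun _ => (0 : ℚ)) (fun _ => (0 : ℚ)) ν
            simp only [add_zero] at this
            linarith
          constructor
          · rw [isPolyFun_iff_iterDiff]
            intro l _ ν
            have := iterDiff_add 1 l (fun _ => (0 : ℚ)) (fun _ => (0 : ℚ)) ν
            simp only [add_zero, Pi.single_zero, sub_self] at this ⊢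
            linarith
          · simpa using h0
        | succ t ih' =>
          have e : (fun ν => F (ν + Pi.single p (t + 1)) - F ν) =
              fun ν => (F (ν + Pi.single p t) - F ν) + diff p F (ν + Pi.single p t) := by
            ext ν
            simp only [diff, single_succ p t, add_assoc]
            ring
          rw [e]
          refine ⟨ih'.1.add ((hF p).shift _), ?_⟩
          rw [iterDiff_add, ih'.2, iterDiff_shift, (hF p).iterDiff_shift_eq hl]
          push_cast
          ring
      change iterDiff t l (fun ν => F (ν + Pi.single p t) - F ν) ν =
        (t : ℚ) ^ (k + 1) * iterDiff 1 l (diff p F) ν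
      rw [ih (key t).1 hl, (key t).2]
      ring

theorem abs_iterDiff_le {m : ℕ} {F : (ι → ℕ) → ℚ} {C a : ℚ} (ha : 0 ≤ a) (hC : 0 ≤ C)
    (h : ∀ ν, |F ν| ≤ C * (a + ∑ i, (ν i : ℚ)) ^ m) (t : ℕ) (l : List ι) (ν : ι → ℕ) :
    |iterDiff t l F ν| ≤ 2 ^ l.length * C * (a + l.length * t + ∑ i, (ν i : ℚ)) ^ m := by
  induction l generalizing F C a with
  | nil => simpa [iterDiff] using h ν
  | cons p l ih =>
    have := ih (F := fun ν => F (ν + Pi.single p t) - F ν) (C := 2 * C) (a := a + t)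
      (by positivity) (by positivity) (fun ν => ?_)
    · refine this.trans (le_of_eq ?_)
      simp only [List.length_cons]
      push_cast
      ring
    · have hs : ∑ i, (((ν + Pi.single p t : ι → ℕ) i : ℕ) : ℚ) = ∑ i, (ν i : ℚ) + t := by
        have h2 : ∑ i, (Pi.single p t : ι → ℕ) i = t := by simp
        have : ∑ i, (ν + Pi.single p t : ι → ℕ) i = ∑ i, ν i + t := by
          simp only [Pi.add_apply, Finset.sum_add_distrib, h2]
        exact_mod_cast this
      have h1 := h (ν + Pi.single p t)
      rw [hs] at h1
      have hn : (0 : ℚ) ≤ ∑ i, (ν i : ℚ) := Finset.sum_nonneg fun i _ => by positivity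
      have h2 := h ν
      generalize (∑ i, (ν i : ℚ)) = n at *
      have h3 : C * (a + n) ^ m ≤ C * (a + (n + t)) ^ m := by
        gcongr; linarith [(Nat.cast_nonneg t : (0 : ℚ) ≤ t)]
      calc _ ≤ |F (ν + Pi.single p t)| + |F ν| := abs_sub _ _
        _ ≤ C * (a + (n + t)) ^ m + C * (a + (n + t)) ^ m := by linarith
        _ = _ := by ring

/-- A polynomial function of degree `≤ k` that grows slower than a power `m < k` has
degree `< k`. -/
theorem IsPolyFun.of_bound {k m : ℕ} (hm : m < k) {F : (ι → ℕ) → ℚ} (hF : IsPolyFun (k + 1) F)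
    {C : ℚ} (hC : 0 ≤ C) (h : ∀ ν, |F ν| ≤ C * (1 + ∑ i, (ν i : ℚ)) ^ m) : IsPolyFun k F := by
  rw [isPolyFun_iff_iterDiff]
  intro l hl ν
  by_contra hx
  have hx : 0 < |iterDiff 1 l F ν| := abs_pos.2 hx
  have hn : (0 : ℚ) ≤ ∑ i, (ν i : ℚ) := Finset.sum_nonneg fun i _ => by positivity
  set n := ∑ i, (ν i : ℚ)
  -- A nonzero difference of order `k` grows like t^k when its steps are stretched to length `t`,
  -- whereas the bound on `F` allows only t^m. This `t` is large enough for a contradiction.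
  obtain ⟨t, ht⟩ := exists_nat_gt (2 ^ k * C * (1 + k + n) ^ m / |iterDiff 1 l F ν|)
  rw [div_lt_iff₀ hx] at ht
  have ht0 : (1 : ℚ) ≤ t := by
    rcases Nat.eq_zero_or_pos t with rfl | h
    · have : 0 ≤ 2 ^ k * C * (1 + k + n) ^ m := by positivity
      norm_num at ht
      linarith
    · exact_mod_cast h
  have h1 := abs_iterDiff_le zero_le_one hC h t l ν
  rw [hF.iterDiff_eq hl, abs_mul, abs_of_nonneg (by positivity), hl] at h1
  have h2 : (1 + k * t + n) ^ m ≤ (1 + k + n) ^ m * (t : ℚ) ^ m := by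
    rw [← mul_pow]
    gcongr
    nlinarith
  have h3 : (t : ℚ) ^ (m + 1) ≤ (t : ℚ) ^ k := pow_le_pow_right₀ ht0 hm
  have h4 : (t : ℚ) ^ m * (t * |iterDiff 1 l F ν|) ≤ (t : ℚ) ^ m * (2 ^ k * C * (1 + k + n) ^ m) :=
    calc _ = (t : ℚ) ^ (m + 1) * |iterDiff 1 l F ν| := by ring
      _ ≤ (t : ℚ) ^ k * |iterDiff 1 l F ν| := by gcongr
      _ ≤ _ := h1
      _ ≤ 2 ^ k * C * ((1 + k + n) ^ m * (t : ℚ) ^ m) := by gcongr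
      _ = _ := by ring
  have := le_of_mul_le_mul_left h4 (by positivity)
  linarith

theorem IsPolyFun.evPol {k : ℕ} {F : (ι → ℕ) → ℚ} (hF : IsPolyFun k F) : EvPol k F := by
  induction k generalizing F with
  | zero => exact .of_forall hF
  | succ k ih => exact fun p => ih (hF p)

/-- The growth of `G` bounds that of `F`, so `IsPolyFun.of_bound` removes the surplus orders one at
a time. If `k = 0`, `F` is squeezed to zero. -/
theorem EvPol.of_le {j k : ℕ} {F G : (ι → ℕ) → ℚ} (hF : EvPol j F) (hG : EvPol k G)
    (h0 : ∀ᶠ ν in atTop, 0 ≤ F ν) (hFG : ∀ᶠ ν in atTop, F ν ≤ G ν) : EvPol k F := by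
  rcases le_total j k with hjk | hjk
  · exact hF.mono hjk
  induction j, hjk using Nat.le_induction with
  | base => exact hF
  | succ i hi ih =>
    refine ih ?_
    cases k with
    | zero =>
      refine EvPol.mono (k := 0) ?_ hi
      filter_upwards [h0, hFG, hG] with ν h1 h2 h3
      linarith
    | succ k =>
      obtain ⟨d₁, h₁⟩ := hF.exists_isPolyFun
      obtain ⟨d₂, h₂⟩ := hG.exists_isPolyFun
      obtain ⟨d₃, h₃⟩ := eventually_atTop.1 (h0.and hFG)
      have h₁ : IsPolyFun (i + 1) (fun ν => F (ν + (d₁ + d₂ + d₃))) := by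
        have := h₁.shift (d₂ + d₃)
        simpa only [add_assoc, add_comm, add_left_comm] using this
      have h₂ : IsPolyFun (k + 1) (fun ν => G (ν + (d₁ + d₂ + d₃))) := by
        have := h₂.shift (d₁ + d₃)
        simpa only [add_assoc, add_comm, add_left_comm] using this
      obtain ⟨C, hC, hb⟩ := h₂.exists_bound
      refine EvPol.of_shift (d₁ + d₂ + d₃) (IsPolyFun.of_bound (m := k) hi h₁ hC fun ν => ?_).evPol
      obtain ⟨h4, h5⟩ := h₃ (ν + (d₁ + d₂ + d₃)) (le_add_of_le_right le_add_self)
      exact (abs_le_abs_of_nonneg h4 h5).trans (hb ν)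

end PolynomialFunctions

/-! ### Eventually polynomial functions and actual polynomials -/

section NewtonInterpolation

variable {ι : Type*} [Fintype ι] [DecidableEq ι]

theorem diff_eq_fwdDiff (p : ι) : diff p = fwdDiff (Pi.single p 1 : ι → ℕ) (G := ℚ) := rfl

theorem IsPolyFun.iterate_diff {k : ℕ} {F : (ι → ℕ) → ℚ} (hF : IsPolyFun k F) (p : ι)
    (ν : ι → ℕ) : (diff p)^[k] F ν = 0 := by
  induction k generalizing F with
  | zero => exact hF ν
  | succ k ih => exact ih (hF p)

/-- Newton's forward difference expansion in the coordinate `p`. It may be cut at `k`: later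
differences vanish, and so do the binomials beyond `ν p`. -/
theorem newton_formula {p : ι} {k : ℕ} {F : (ι → ℕ) → ℚ} (hF : ∀ ν, (diff p)^[k] F ν = 0)
    (ν : ι → ℕ) : F ν = ∑ j ∈ Finset.range k,
      ((ν p).choose j : ℚ) * ((diff p)^[j] F) (Function.update ν p 0) := by
  have h := shift_eq_sum_fwdDiff_iter (Pi.single p 1 : ι → ℕ) F (ν p) (Function.update ν p 0)
  have e : Function.update ν p 0 + ν p • (Pi.single p 1 : ι → ℕ) = ν := by
    ext i
    rcases eq_or_ne i p with rfl | h <;> simp [*]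
  rw [e] at h
  rw [h]
  simp only [nsmul_eq_mul, ← diff_eq_fwdDiff]
  have hz : ∀ j, k ≤ j → ∀ μ, (diff p)^[j] F μ = 0 := by
    intro j hj
    induction j, hj using Nat.le_induction with
    | base => exact hF
    | succ j _ ih =>
      intro μ
      rw [Function.iterate_succ_apply']
      simp [diff, ih]
  rcases le_total k (ν p + 1) with hk | hk
  · refine (Finset.sum_subset (Finset.range_mono hk) fun j _ hj => ?_).symm
    rw [hz j (by simpa using hj), mul_zero]
  · refine Finset.sum_subset (Finset.range_mono hk) fun j _ hj => ?_
    rw [Nat.choose_eq_zero_of_lt (by simpa using hj), Nat.cast_zero, zero_mul]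

theorem exists_eval_eq_choose (p : ι) (j : ℕ) : ∃ P : MvPolynomial ι ℚ, ∀ ν : ι → ℕ,
    ((ν p).choose j : ℚ) = MvPolynomial.eval (fun i => (ν i : ℚ)) P := by
  refine ⟨MvPolynomial.C ((j.factorial : ℚ)⁻¹) *
    Polynomial.aeval (MvPolynomial.X p) (descPochhammer ℚ j), fun ν => ?_⟩
  have h : MvPolynomial.eval (fun i => (ν i : ℚ))
      (Polynomial.aeval (MvPolynomial.X p) (descPochhammer ℚ j)) =
      (descPochhammer ℚ j).eval (ν p : ℚ) := by
    rw [Polynomial.aeval_def, Polynomial.hom_eval₂, MvPolynomial.eval_X, Polynomial.eval]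
    congr 1
    exact Subsingleton.elim _ _
  rw [map_mul, h, descPochhammer_eval_eq_descFactorial, MvPolynomial.eval_C,
    Nat.choose_eq_descFactorial_div_factorial, Nat.cast_div (Nat.factorial_dvd_descFactorial _ _)
    (by exact_mod_cast Nat.factorial_ne_zero j), div_eq_inv_mul]

theorem diff_update {p p' : ι} (h : p' ≠ p) (F : (ι → ℕ) → ℚ) :
    diff p' (fun ν => F (Function.update ν p 0)) = fun ν => diff p' F (Function.update ν p 0) := by
  ext ν
  have : Function.update (ν + Pi.single p' 1) p 0 = Function.update ν p 0 + Pi.single p' 1 := by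
    ext i
    rcases eq_or_ne i p with rfl | hi
    · simp [h.symm]
    · simp [hi]
  simp only [diff, this]

theorem iterate_diff_update {p p' : ι} (h : p' ≠ p) (k : ℕ) (F : (ι → ℕ) → ℚ) :
    (diff p')^[k] (fun ν => F (Function.update ν p 0)) =
      fun ν => (diff p')^[k] F (Function.update ν p 0) := by
  induction k generalizing F with
  | zero => rfl
  | succ k ih => rw [Function.iterate_succ_apply, diff_update h, ih]; rfl

theorem diff_comm (p p' : ι) : Function.Commute (diff p) (diff p') := by
  intro F
  ext ν
  simp only [diff, add_right_comm ν (Pi.single p 1) (Pi.single p' 1)]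
  ring

theorem iterate_diff_zero (p : ι) (k : ℕ) : (diff p)^[k] (fun _ => (0 : ℚ)) = fun _ => 0 := by
  induction k with
  | zero => rfl
  | succ k ih => rw [Function.iterate_succ_apply', ih]; ext; simp [diff]

/-- Induction on the set `T` of coordinates on which `F` may depend: the Newton coefficients in the
coordinate `p` no longer depend on `p`. -/
theorem exists_eval_eq_of_iterate_diff (k : ℕ) (T : Finset ι) : ∀ F : (ι → ℕ) → ℚ,
    (∀ p ∈ T, ∀ ν, (diff p)^[k] F ν = 0) → (∀ p ∉ T, ∀ ν, F (Function.update ν p 0) = F ν) →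
    ∃ P : MvPolynomial ι ℚ, ∀ ν, F ν = MvPolynomial.eval (fun i => (ν i : ℚ)) P := by
  induction T using Finset.induction_on with
  | empty =>
    intro F _ h
    refine ⟨MvPolynomial.C (F 0), fun ν => ?_⟩
    rw [MvPolynomial.eval_C]
    have : ∀ s : Finset ι, F (fun i => if i ∈ s then 0 else ν i) = F ν := by
      intro s
      induction s using Finset.induction_on with
      | empty => simp
      | insert p s hp ih =>
        rw [← ih, ← h p (by simp)]
        conv_rhs => rw [← h p (by simp)]
        congr 1
        ext i
        rcases eq_or_ne i p with rfl | hi <;> simp [*]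
    rw [← this Finset.univ]
    congr 1
    ext i
    simp
  | insert p T hp ih =>
    intro F h1 h2
    have key : ∀ j, ∃ P : MvPolynomial ι ℚ, ∀ ν,
        ((diff p)^[j] F) (Function.update ν p 0) = MvPolynomial.eval (fun i => (ν i : ℚ)) P := by
      intro j
      refine ih (fun ν => ((diff p)^[j] F) (Function.update ν p 0)) (fun p' hp' ν => ?_)
        fun p' hp' ν => ?_
      · have hne : p' ≠ p := fun h => hp (h ▸ hp')
        have h3 : (diff p')^[k] F = fun _ => 0 :=
          funext fun ν => h1 p' (Finset.mem_insert_of_mem hp') ν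
        rw [iterate_diff_update hne, ((diff_comm p' p).iterate_iterate k j).eq, h3,
          iterate_diff_zero]
      · rcases eq_or_ne p' p with rfl | hne
        · simp
        · have h4 : (fun ν => F (Function.update ν p' 0)) = F :=
            funext fun ν => h2 p' (by simp [hne, hp']) ν
          have h5 := iterate_diff_update (p := p') (p' := p) hne.symm j F
          rw [h4] at h5
          rw [Function.update_comm hne, ← congrFun h5 (Function.update ν p 0)]
    choose P hP using key
    choose Q hQ using exists_eval_eq_choose p
    refine ⟨∑ j ∈ Finset.range k, Q j * P j, fun ν => ?_⟩
    rw [newton_formula (h1 p (Finset.mem_insert_self _ _)) ν, map_sum]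
    refine Finset.sum_congr rfl fun j _ => ?_
    rw [map_mul, ← hQ, ← hP]

/-- Needed because `hilbertPolynomial` defaults to 0: only once existence is known does its degree
say anything about the ranks. -/
theorem EvPol.exists_eval_eq {k : ℕ} {F : (ι → ℕ) → ℚ} (hF : EvPol k F) :
    ∃ P : MvPolynomial ι ℚ, ∀ᶠ ν in atTop, F ν = MvPolynomial.eval (fun i => (ν i : ℚ)) P := by
  obtain ⟨d, hd⟩ := hF.exists_isPolyFun
  obtain ⟨P, hP⟩ := exists_eval_eq_of_iterate_diff k Finset.univ _
    (fun p _ ν => hd.iterate_diff p ν) (by simp)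
  -- Substituting X_i - d_i undoes the translation by `d`.
  refine ⟨MvPolynomial.bind₁ (fun i => MvPolynomial.X i - MvPolynomial.C (d i : ℚ)) P,
    eventually_of_eventually_shift d (.of_forall fun ν => ?_)⟩
  rw [hP ν]
  simp only [MvPolynomial.eval, MvPolynomial.eval₂Hom_bind₁]
  simp

theorem EvPol.coord_mul {k : ℕ} {F : (ι → ℕ) → ℚ} (hF : EvPol k F) (p : ι) :
    EvPol (k + 1) (fun ν => (ν p : ℚ) * F ν) := by
  induction k generalizing F with
  | zero =>
    refine EvPol.succ (k := 0) ?_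
    filter_upwards [hF] with ν h
    rw [h, mul_zero]
  | succ k ih =>
    intro p'
    refine ((ih (hF p')).add ((hF.shift (Pi.single p' 1)).const_mul
      (((Pi.single p' 1 : ι → ℕ) p : ℕ) : ℚ))).congr (.of_forall fun ν => ?_)
    simp only [diff, Pi.add_apply]
    push_cast
    ring

theorem evPol_const (c : ℚ) : EvPol 1 (fun _ : ι → ℕ => c) :=
  fun p => .of_forall fun ν => by simp [diff]

theorem evPol_prod_pow (s : ι → ℕ) (T : Finset ι) :
    EvPol (∑ i ∈ T, s i + 1) (fun ν : ι → ℕ => ∏ i ∈ T, (ν i : ℚ) ^ s i) := by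
  induction T using Finset.induction_on with
  | empty => simpa using evPol_const 1
  | insert p T hp ih =>
    simp only [Finset.sum_insert hp, Finset.prod_insert hp]
    generalize s p = m
    induction m with
    | zero => simpa using ih
    | succ m ih' =>
      have := ih'.coord_mul p
      rw [add_right_comm m 1, add_right_comm (m + _) 1]
      exact this.congr (.of_forall fun ν => by ring)

theorem evPol_eval (P : MvPolynomial ι ℚ) :
    EvPol (P.totalDegree + 1) (fun ν : ι → ℕ => MvPolynomial.eval (fun i => (ν i : ℚ)) P) := by
  have key : ∀ T ⊆ P.support, EvPol (P.totalDegree + 1)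
      (fun ν : ι → ℕ => ∑ s ∈ T, P.coeff s * ∏ i, (ν i : ℚ) ^ s i) := by
    intro T hT
    induction T using Finset.induction_on with
    | empty => simpa using (evPol_const (ι := ι) 0).mono (by omega)
    | insert s T hs ih =>
      simp only [Finset.sum_insert hs]
      refine EvPol.add (((evPol_prod_pow s Finset.univ).const_mul _).mono ?_)
        (ih ((Finset.subset_insert _ _).trans hT))
      have := MvPolynomial.le_totalDegree (hT (Finset.mem_insert_self _ _))
      rw [Finsupp.sum_fintype _ _ (fun _ => rfl)] at this
      omega
  refine (key _ subset_rfl).congr (.of_forall fun ν => ?_)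
  exact (MvPolynomial.eval_eq' _ _).symm

end NewtonInterpolation

/-! ### Lengths of subquotients after localization -/

section LocalizedLength

variable {A : Type*} [CommRing A] (S : Submonoid A)

/-- The length of `S⁻¹ N` over `S⁻¹ A`. -/
noncomputable def len (N : Type*) [AddCommGroup N] [Module A N] : ℕ∞ :=
  Module.length (Localization S) (LocalizedModule S N)

variable {N N' N'' : Type*} [AddCommGroup N] [Module A N] [AddCommGroup N'] [Module A N']
  [AddCommGroup N''] [Module A N'']

theorem localLength_eq_len (p : PrimeSpectrum A) :
    localLength A N p = len p.asIdeal.primeCompl N := rfl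

theorem localizedMap_exact {f : N →ₗ[A] N'} {g : N' →ₗ[A] N''} (h : Function.Exact f g) :
    Function.Exact (LocalizedModule.map S f) (LocalizedModule.map S g) :=
  LocalizedModule.map_exact S f g h

theorem len_eq_add_of_exact {f : N →ₗ[A] N'} {g : N' →ₗ[A] N''} (hf : Function.Injective f)
    (hg : Function.Surjective g) (h : Function.Exact f g) : len S N' = len S N + len S N'' :=
  Module.length_eq_add_of_exact (LocalizedModule.map S f) (LocalizedModule.map S g)
    (LocalizedModule.map_injective S f hf) (LocalizedModule.map_surjective S g hg)
    (localizedMap_exact S h)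

theorem len_le_of_injective {f : N →ₗ[A] N'} (hf : Function.Injective f) : len S N ≤ len S N' :=
  Module.length_le_of_injective (LocalizedModule.map S f) (LocalizedModule.map_injective S f hf)

theorem len_le_of_surjective {f : N →ₗ[A] N'} (hf : Function.Surjective f) :
    len S N' ≤ len S N :=
  Module.length_le_of_surjective (LocalizedModule.map S f) (LocalizedModule.map_surjective S f hf)

theorem len_congr (e : N ≃ₗ[A] N') : len S N = len S N' :=
  le_antisymm (len_le_of_injective S (f := e.toLinearMap) e.injective)
    (len_le_of_surjective S (f := e.toLinearMap) e.surjective)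

theorem len_eq_zero_iff : len S N = 0 ↔ ∀ m : N, ∃ s ∈ S, s • m = 0 := by
  rw [len, Module.length_eq_zero_iff, LocalizedModule.subsingleton_iff]

/-- The length of the image of `Y` in `M / X`, after localization. -/
noncomputable def relLen (X Y : Submodule A N) : ℕ∞ := len S (Y.map X.mkQ)

variable {S}

theorem relLen_mono {X Y Y' : Submodule A N} (h : Y ≤ Y') : relLen S X Y ≤ relLen S X Y' :=
  len_le_of_injective S (f := Submodule.inclusion (Submodule.map_mono h))
    (Submodule.inclusion_injective _)

theorem relLen_sup (X Y : Submodule A N) : relLen S X (X ⊔ Y) = relLen S X Y := by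
  rw [relLen, relLen, Submodule.map_sup, Submodule.mkQ_map_self, bot_sup_eq]

theorem relLen_eq_zero_iff {X Y : Submodule A N} :
    relLen S X Y = 0 ↔ ∀ y ∈ Y, ∃ s ∈ S, s • y ∈ X := by
  rw [relLen, len_eq_zero_iff]
  refine ⟨fun h y hy => ?_, fun h => ?_⟩
  · obtain ⟨s, hs, h⟩ := h ⟨X.mkQ y, Submodule.mem_map_of_mem hy⟩
    refine ⟨s, hs, ?_⟩
    rw [← Submodule.Quotient.mk_eq_zero]
    exact congrArg Subtype.val h
  · rintro ⟨_, y, hy, rfl⟩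
    obtain ⟨s, hs, h⟩ := h y hy
    refine ⟨s, hs, Subtype.ext ?_⟩
    change s • X.mkQ y = 0
    rw [← map_smul]
    exact (Submodule.Quotient.mk_eq_zero _).2 h

theorem relLen_of_le {X Y : Submodule A N} (h : Y ≤ X) : relLen S X Y = 0 :=
  relLen_eq_zero_iff.2 fun y hy => ⟨1, S.one_mem, by simpa using h hy⟩

/-- Both images are quotients of `Y` by the same kernel. Lengths are thus transported without
building isomorphisms of subquotients. -/
theorem len_map_eq_of_ker {P P' : Type*} [AddCommGroup P] [Module A P] [AddCommGroup P']
    [Module A P'] (g : N →ₗ[A] P) (g' : N' →ₗ[A] P') (φ : N →ₗ[A] N') {Y : Submodule A N}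
    (h : ∀ y ∈ Y, g y = 0 ↔ g' (φ y) = 0) : len S (Y.map g) = len S ((Y.map φ).map g') := by
  have e1 : len S (Y.map g) = len S (Y ⧸ LinearMap.ker (g ∘ₗ Y.subtype)) := by
    have := len_congr S (g ∘ₗ Y.subtype).quotKerEquivRange
    rw [this, LinearMap.range_comp, Submodule.range_subtype]
  have e2 : len S ((Y.map φ).map g') = len S (Y ⧸ LinearMap.ker (g' ∘ₗ φ ∘ₗ Y.subtype)) := by
    have := len_congr S (g' ∘ₗ φ ∘ₗ Y.subtype).quotKerEquivRange
    rw [this, LinearMap.range_comp, LinearMap.range_comp, Submodule.range_subtype]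
  rw [e1, e2]
  have : LinearMap.ker (g ∘ₗ Y.subtype) = LinearMap.ker (g' ∘ₗ φ ∘ₗ Y.subtype) := by
    ext ⟨y, hy⟩
    exact h y hy
  rw [this]

theorem relLen_map (φ : N →ₗ[A] N') {X : Submodule A N} {X' : Submodule A N'}
    {Y : Submodule A N} (h : ∀ y ∈ Y, y ∈ X ↔ φ y ∈ X') :
    relLen S X' (Y.map φ) = relLen S X Y := by
  refine (len_map_eq_of_ker X.mkQ X'.mkQ φ fun y hy => ?_).symm
  simpa using h y hy

theorem relLen_congr {X X' Y : Submodule A N} (h : ∀ y ∈ Y, y ∈ X ↔ y ∈ X') :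
    relLen S X Y = relLen S X' Y := by
  have := relLen_map (S := S) LinearMap.id h
  rw [Submodule.map_id] at this
  exact this.symm

theorem relLen_add {X Y Z : Submodule A N} (hXY : X ≤ Y) (hYZ : Y ≤ Z) :
    relLen S X Z = relLen S X Y + relLen S Y Z := by
  have hg : ∀ z ∈ Z.map X.mkQ, Submodule.factor hXY z ∈ Z.map Y.mkQ := by
    rintro _ ⟨z, hz, rfl⟩
    exact ⟨z, hz, rfl⟩
  refine len_eq_add_of_exact S (f := Submodule.inclusion (Submodule.map_mono hYZ))
    (g := (Submodule.factor hXY).restrict hg) (Submodule.inclusion_injective _) ?_ ?_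
  · rintro ⟨_, z, hz, rfl⟩
    exact ⟨⟨X.mkQ z, z, hz, rfl⟩, rfl⟩
  · rintro ⟨_, z, hz, rfl⟩
    constructor
    · intro h
      have : z ∈ Y := (Submodule.Quotient.mk_eq_zero _).1 (congrArg Subtype.val h)
      exact ⟨⟨X.mkQ z, z, this, rfl⟩, rfl⟩
    · rintro ⟨⟨_, y, hy, rfl⟩, h⟩
      have h : X.mkQ y = X.mkQ z := congrArg Subtype.val h
      have : y - z ∈ X := (Submodule.Quotient.eq _).1 h
      refine Subtype.ext ((Submodule.Quotient.mk_eq_zero _).2 ?_)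
      have := Y.sub_mem hy (hXY this)
      simpa using this

theorem relLen_mono_left {X X' Y : Submodule A N} (h : X ≤ X') : relLen S X' Y ≤ relLen S X Y := by
  have hg : ∀ z ∈ Y.map X.mkQ, Submodule.factor h z ∈ Y.map X'.mkQ := by
    rintro _ ⟨z, hz, rfl⟩
    exact ⟨z, hz, rfl⟩
  refine len_le_of_surjective S (f := (Submodule.factor h).restrict hg) ?_
  rintro ⟨_, z, hz, rfl⟩
  exact ⟨⟨X.mkQ z, z, hz, rfl⟩, rfl⟩

end LocalizedLength

/-! ### Finite length at height-one primes, and generic rank as a length -/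

section CommutativeAlgebra

/-- `X` is a quotient of a finite power of R/(c), which has finite length in dimension at most one.
-/
theorem isFiniteLength_of_smul_eq_zero {R : Type*} [CommRing R] [IsDomain R] [IsNoetherianRing R]
    [Ring.KrullDimLE 1 R] {X : Type*} [AddCommGroup X] [Module R X] [Module.Finite R X] {c : R}
    (hc : c ≠ 0) (h : ∀ x : X, c • x = 0) : IsFiniteLength R X := by
  have h1 := isFiniteLength_quotient_span_singleton R (mem_nonZeroDivisors_of_ne_zero hc)
  rw [isFiniteLength_iff_isNoetherian_isArtinian] at h1 ⊢
  refine ⟨inferInstance, ?_⟩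
  have := h1.2
  obtain ⟨n, f, hf⟩ := Module.Finite.exists_fin' R X
  let g : Fin n → (R ⧸ Ideal.span {c}) →ₗ[R] X := fun i =>
    Submodule.liftQ _ (LinearMap.toSpanSingleton R X (f (Pi.single i 1))) (by
      rw [Ideal.span, Submodule.span_singleton_le_iff_mem]
      simpa using h _)
  refine isArtinian_of_surjective (M := Fin n → R ⧸ Ideal.span {c})
    (LinearMap.lsum R (fun _ => R ⧸ Ideal.span {c}) R g) fun x => ?_
  obtain ⟨v, rfl⟩ := hf x
  refine ⟨fun i => Ideal.Quotient.mk _ (v i), ?_⟩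
  rw [LinearMap.lsum_apply, LinearMap.sum_apply]
  conv_rhs => rw [← Finset.univ_sum_single v, map_sum]
  refine Finset.sum_congr rfl fun i _ => ?_
  have : (Pi.single i (v i) : Fin n → R) = v i • Pi.single i 1 := by
    rw [← Pi.single_smul', smul_eq_mul, mul_one]
  rw [this, map_smul]
  rfl

variable {A : Type*} [CommRing A] [IsDomain A] [IsNoetherianRing A]

theorem len_ne_top_of_smul_eq_zero {p : PrimeSpectrum A} (hp : p.asIdeal.height = 1)
    {N : Type*} [AddCommGroup N] [Module A N] [Module.Finite A N] {c : A}
    (hc : c ≠ 0) (h : ∀ x : N, c • x = 0) : len p.asIdeal.primeCompl N ≠ ⊤ := by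
  have hle : p.asIdeal.primeCompl ≤ nonZeroDivisors A := p.asIdeal.primeCompl_le_nonZeroDivisors
  have : IsDomain (Localization p.asIdeal.primeCompl) := IsLocalization.isDomain_localization hle
  have : IsNoetherianRing (Localization p.asIdeal.primeCompl) :=
    IsLocalization.isNoetherianRing p.asIdeal.primeCompl _ inferInstance
  have : Ring.KrullDimLE 1 (Localization p.asIdeal.primeCompl) := by
    have := IsLocalization.AtPrime.ringKrullDim_eq_height p.asIdeal (Localization.AtPrime p.asIdeal)
    rw [hp] at this
    rw [Ring.KrullDimLE, Order.krullDimLE_iff]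
    exact this.le
  rw [len, Module.length_ne_top_iff]
  refine isFiniteLength_of_smul_eq_zero (c := algebraMap A _ c)
    ((map_ne_zero_iff _ (IsLocalization.injective _ hle)).2 hc) fun x => ?_
  rw [algebraMap_smul]
  induction x using LocalizedModule.induction_on with
  | h m s => rw [LocalizedModule.smul'_mk, h, LocalizedModule.zero_mk]

/-- Makes the generic rank a length, so that one additive calculus serves for ranks and for lengths
at `p`. -/
theorem len_nonZeroDivisors (N : Type*) [AddCommGroup N] [Module A N] [Module.Finite A N] :
    len (nonZeroDivisors A) N = Module.finrank A N := by
  rw [len]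
  let _ : Field (Localization (nonZeroDivisors A)) :=
    inferInstanceAs (Field (FractionRing A))
  have h1 := Module.length_eq_finrank (Localization (nonZeroDivisors A))
    (LocalizedModule (nonZeroDivisors A) N)
  refine h1.trans ?_
  rw [IsLocalization.finrank_eq (R := A) (Localization (nonZeroDivisors A)) (nonZeroDivisors A) le_rfl,
    IsLocalizedModule.finrank_eq (nonZeroDivisors A) (LocalizedModule.mkLinearMap (nonZeroDivisors A) N) le_rfl]

theorem genericRank_eq (N : Type*) [AddCommGroup N] [Module A N] :
    genericRank A N = Module.finrank A N := by
  have : IsLocalizedModule (nonZeroDivisors A) (TensorProduct.mk A (FractionRing A) N 1) :=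
    (isLocalizedModule_iff_isBaseChange (nonZeroDivisors A) (FractionRing A) _).2
      (TensorProduct.isBaseChange A N (FractionRing A))
  rw [genericRank, IsLocalization.finrank_eq (R := A) (FractionRing A) (nonZeroDivisors A) le_rfl,
    IsLocalizedModule.finrank_eq (nonZeroDivisors A) (TensorProduct.mk A (FractionRing A) N 1)
      le_rfl]

theorem exists_linearMap_torsion_coker (N : Type*) [AddCommGroup N] [Module A N]
    [Module.Finite A N] : ∃ l : (Fin (Module.finrank A N) → A) →ₗ[A] N,
      Function.Injective l ∧ ∀ y : N, ∃ c : A, c ≠ 0 ∧ c • y ∈ LinearMap.range l := by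
  obtain ⟨b, hb⟩ := exists_linearIndependent_of_le_finrank (le_refl (Module.finrank A N))
  have hl : Function.Injective (Fintype.linearCombination A b) :=
    hb.fintypeLinearCombination_injective
  refine ⟨Fintype.linearCombination A b, hl, fun y => ?_⟩
  have h1 := (LinearMap.range (Fintype.linearCombination A b)).finrank_quotient_add_finrank
  rw [LinearMap.finrank_range_of_inj hl, Module.finrank_fin_fun, Nat.add_eq_right,
    Module.finrank_eq_zero_iff_isTorsion] at h1
  obtain ⟨c, hc⟩ := @h1 (Submodule.Quotient.mk y)
  exact ⟨c, nonZeroDivisors.coe_ne_zero c, (Submodule.Quotient.mk_eq_zero _).1 hc⟩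

theorem len_pi_fin (S : Submonoid A) (Q : Type*) [AddCommGroup Q] [Module A Q] (n : ℕ) :
    len S (Fin n → Q) = n * len S Q := by
  induction n with
  | zero =>
    rw [Nat.cast_zero, zero_mul, len_eq_zero_iff]
    exact fun m => ⟨1, S.one_mem, Subsingleton.elim _ _⟩
  | succ n ih =>
    have := len_eq_add_of_exact S (f := LinearMap.single A (fun _ : Fin (n + 1) => Q) 0)
      (g := LinearMap.funLeft A Q Fin.succ) (Pi.single_injective (M := fun _ => Q) 0)
      (LinearMap.funLeft_surjective_of_injective _ _ _ (Fin.succ_injective n)) ?_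
    · rw [this, ih]
      push_cast
      ring
    · intro x
      constructor
      · intro h
        refine ⟨x 0, ?_⟩
        ext i
        refine Fin.cases (by simp) (fun j => ?_) i
        have := congrFun h j
        simpa [LinearMap.funLeft] using this.symm
      · rintro ⟨y, rfl⟩
        ext j
        simp [LinearMap.funLeft]

/-- Torsion killed by one element. -/
theorem exists_smul_le {N : Type*} [AddCommGroup N] [Module A N] {X Y : Submodule A N}
    (hY : Y.FG) (h : ∀ y ∈ Y, ∃ c : A, c ≠ 0 ∧ c • y ∈ X) :
    ∃ c : A, c ≠ 0 ∧ ∀ y ∈ Y, c • y ∈ X := by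
  obtain ⟨s, rfl⟩ := hY
  choose! c hc hcy using h
  refine ⟨∏ y ∈ s, c y, Finset.prod_ne_zero_iff.2 fun y hy => hc y (Submodule.subset_span hy),
    fun y hy => ?_⟩
  induction hy using Submodule.span_induction with
  | mem y hy =>
    obtain ⟨d, hd⟩ := Finset.dvd_prod_of_mem c hy
    rw [hd, mul_comm, mul_smul]
    exact X.smul_mem _ (hcy y (Submodule.subset_span hy))
  | zero => simp
  | add a b _ _ ha hb => rw [smul_add]; exact X.add_mem ha hb
  | smul a b _ hb => rw [smul_comm]; exact X.smul_mem _ hb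

theorem relLen_ne_top {p : PrimeSpectrum A} (hp : p.asIdeal.height = 1)
    {N : Type*} [AddCommGroup N] [Module A N] {X Y : Submodule A N}
    (hY : Y.FG) (h : ∀ y ∈ Y, ∃ c : A, c ≠ 0 ∧ c • y ∈ X) :
    relLen p.asIdeal.primeCompl X Y ≠ ⊤ := by
  obtain ⟨c, hc, hcY⟩ := exists_smul_le hY h
  have : Module.Finite A (Y.map X.mkQ) := Module.Finite.iff_fg.2 (hY.map _)
  refine len_ne_top_of_smul_eq_zero hp hc ?_
  rintro ⟨_, y, hy, rfl⟩
  refine Subtype.ext ((Submodule.Quotient.mk_eq_zero _).2 (hcY y hy))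

/-- Let F ⊆ N be free of full rank. In the chains cF ⊆ cN ⊆ N and cF ⊆ F ⊆ N one has cN/cF ≅ N/F, so
N/cN and F/cF have the same length at `p`. -/
theorem len_quotient_smul_le {p : PrimeSpectrum A} (hp : p.asIdeal.height = 1)
    (N : Type*) [AddCommGroup N] [Module A N] [Module.Finite A N] [Module.IsTorsionFree A N]
    {c : A} (hc : c ≠ 0) :
    relLen p.asIdeal.primeCompl ((⊤ : Submodule A N).map (LinearMap.lsmul A N c)) ⊤ ≤
      Module.finrank A N * len p.asIdeal.primeCompl (A ⧸ Ideal.span {c}) := by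
  obtain ⟨l, hl, hN⟩ := exists_linearMap_torsion_coker (A := A) N
  set S := p.asIdeal.primeCompl
  set F := LinearMap.range l
  have hinj : Function.Injective (LinearMap.lsmul A N c) := smul_right_injective N hc
  have h1 : relLen S (F.map (LinearMap.lsmul A N c)) (Submodule.map (LinearMap.lsmul A N c) ⊤) =
      relLen S F ⊤ := relLen_map _ fun y _ => (hinj.mem_set_image (s := F)).symm
  have h2 : F.map (LinearMap.lsmul A N c) ≤ F := by
    rintro _ ⟨y, hy, rfl⟩
    exact F.smul_mem c hy
  have h3 := relLen_add (S := S) (Submodule.map_mono (f := LinearMap.lsmul A N c) (le_top (a := F))) le_top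
  have h4 := relLen_add (S := S) h2 le_top
  rw [h1] at h3
  -- Finiteness of this length is what permits cancelling it in `ℕ∞`.
  have hfin : relLen S F ⊤ ≠ ⊤ := relLen_ne_top hp Module.Finite.fg_top fun y _ => hN y
  have h5 : relLen S ((⊤ : Submodule A N).map (LinearMap.lsmul A N c)) ⊤ =
      relLen S (F.map (LinearMap.lsmul A N c)) F := by
    rw [h4, add_comm] at h3
    exact (ENat.add_right_injective_of_ne_top hfin h3).symm
  have h6 : relLen S (F.map (LinearMap.lsmul A N c)) F =
      relLen S ((⊤ : Submodule A (Fin (Module.finrank A N) → A)).map (LinearMap.lsmul A _ c)) ⊤ := by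
    rw [← relLen_map l (X' := F.map (LinearMap.lsmul A N c)), Submodule.map_top]
    intro v _
    constructor
    · rintro ⟨w, -, rfl⟩
      exact ⟨l w, ⟨w, rfl⟩, by simp⟩
    · rintro ⟨_, ⟨w, rfl⟩, h⟩
      refine ⟨w, trivial, hl ?_⟩
      rw [← h]; simp
  rw [h5, h6, ← len_pi_fin]
  have h7 : relLen S ((⊤ : Submodule A (Fin (Module.finrank A N) → A)).map
      (LinearMap.lsmul A _ c)) ⊤ = _ := len_map_eq_of_ker _
        ((Ideal.span {c}).mkQ.compLeft (Fin (Module.finrank A N))) LinearMap.id fun v _ => ?_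
  · rw [h7]
    exact len_le_of_injective S (Submodule.subtype_injective _)
  · rw [Submodule.mkQ_apply, Submodule.Quotient.mk_eq_zero]
    have h8 : ∀ a : A, (Ideal.span {c}).mkQ a = 0 ↔ ∃ b, c * b = a := fun a => by
      rw [Submodule.mkQ_apply, Submodule.Quotient.mk_eq_zero, Ideal.mem_span_singleton]
      exact ⟨fun ⟨b, hb⟩ => ⟨b, hb.symm⟩, fun ⟨b, hb⟩ => ⟨b, hb.symm⟩⟩
    constructor
    · rintro ⟨w, -, rfl⟩
      ext i
      exact (h8 _).2 ⟨w i, rfl⟩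
    · intro h
      choose w hw using fun i => (h8 (v i)).1 (congrFun h i)
      exact ⟨w, trivial, funext hw⟩

end CommutativeAlgebra

/-! ### Multigraded submodules, given by their components -/

section GradedSubmodules

variable {q : ℕ} (n : Fin q → ℕ) {A : Type*} [CommRing A] {M : Type*} [AddCommGroup M]
  [Module A M] [Module (Poly n A) M] [IsScalarTower A (Poly n A) M]

/-- Multiplication by a polynomial as an `A`-linear map. -/
noncomputable def mulMap (g : Poly n A) : M →ₗ[A] M := Algebra.lsmul A A M g

@[simp]
theorem mulMap_apply (g : Poly n A) (m : M) : mulMap n g m = g • m := rfl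

/-- The family `U` is the family of components of a multigraded submodule. -/
structure IsGradedSub (ℳ U : (Fin q → ℕ) → Submodule A M) : Prop where
  le : ∀ ν, U ν ≤ ℳ ν
  X_smul_mem : ∀ v ν m, m ∈ U ν → (MvPolynomial.X v : Poly n A) • m ∈ U (ν + varDegree n v)

variable {n} {ℳ U V : (Fin q → ℕ) → Submodule A M}

theorem IsGrading.isGradedSub (hℳ : IsGrading n ℳ) : IsGradedSub n ℳ ℳ where
  le _ := le_rfl
  X_smul_mem v ν m hm := by
    rw [add_comm]
    exact hℳ.smul_mem _ _ _ _ (MvPolynomial.isWeightedHomogeneous_X A (varDegree n) v) hm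

theorem isGradedSub_bot : IsGradedSub n ℳ (fun _ => ⊥) where
  le _ := bot_le
  X_smul_mem v ν m hm := by
    rw [Submodule.mem_bot] at *
    rw [hm, smul_zero]

theorem IsGradedSub.sup (hU : IsGradedSub n ℳ U) (hV : IsGradedSub n ℳ V) :
    IsGradedSub n ℳ (fun ν => U ν ⊔ V ν) where
  le ν := sup_le (hU.le ν) (hV.le ν)
  X_smul_mem v ν m hm := by
    obtain ⟨a, ha, b, hb, rfl⟩ := Submodule.mem_sup.1 hm
    rw [smul_add]
    exact Submodule.add_mem_sup (hU.X_smul_mem v ν a ha) (hV.X_smul_mem v ν b hb)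

theorem smul_smul_A_comm (a : A) (g : Poly n A) (m : M) : g • a • m = a • g • m :=
  ((mulMap n g).map_smul a m)

theorem IsGradedSub.monomial_smul_mem (hU : IsGradedSub n ℳ U) (s : Vars n →₀ ℕ) (a : A) :
    ∀ ν, ∀ m ∈ U ν, (MvPolynomial.monomial s a : Poly n A) • m ∈
      U (ν + Finsupp.weight (varDegree n) s) := by
  have key : ∀ ν, ∀ m ∈ U ν, (MvPolynomial.monomial s 1 : Poly n A) • m ∈
      U (ν + Finsupp.weight (varDegree n) s) := by
    induction s using Finsupp.induction_linear with
    | zero =>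
      intro ν m hm
      change (1 : Poly n A) • m ∈ _
      simpa using hm
    | add f g hf hg =>
      intro ν m hm
      have : (MvPolynomial.monomial (f + g) 1 : Poly n A) =
          MvPolynomial.monomial f 1 * MvPolynomial.monomial g 1 := by
        rw [MvPolynomial.monomial_mul, one_mul]
      rw [this, mul_smul, map_add, add_comm (Finsupp.weight _ f), ← add_assoc]
      exact hf _ _ (hg _ _ hm)
    | single v k =>
      intro ν m hm
      rw [← MvPolynomial.X_pow_eq_monomial, Finsupp.weight_single]
      induction k with
      | zero => simpa using hm
      | succ k ih =>
        rw [pow_succ', mul_smul, succ_nsmul, ← add_assoc]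
        exact hU.X_smul_mem _ _ _ ih
  intro ν m hm
  have : (MvPolynomial.monomial s a : Poly n A) = a • MvPolynomial.monomial s 1 := by
    rw [MvPolynomial.smul_monomial, smul_eq_mul, mul_one]
  rw [this, smul_assoc]
  exact Submodule.smul_mem _ _ (key ν m hm)

theorem IsGradedSub.smul_mem (hU : IsGradedSub n ℳ U) {d : Fin q → ℕ} {g : Poly n A}
    (hg : g ∈ polyComponent n A d) {ν : Fin q → ℕ} {m : M} (hm : m ∈ U ν) :
    g • m ∈ U (ν + d) := by
  rw [← MvPolynomial.support_sum_monomial_coeff g, Finset.sum_smul]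
  refine Submodule.sum_mem _ fun s hs => ?_
  have : Finsupp.weight (varDegree n) s = d := hg (MvPolynomial.mem_support_iff.1 hs)
  rw [← this]
  exact hU.monomial_smul_mem s _ ν m hm

/-- The family of components of `g U`, with `g` of multidegree `d`. -/
noncomputable def shiftMul (d : Fin q → ℕ) (g : Poly n A) (U : (Fin q → ℕ) → Submodule A M) :
    (Fin q → ℕ) → Submodule A M :=
  fun μ => ⨆ (ν : Fin q → ℕ) (_ : ν + d = μ), (U ν).map (mulMap n g)

theorem shiftMul_add (d : Fin q → ℕ) (g : Poly n A) (U : (Fin q → ℕ) → Submodule A M)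
    (ν : Fin q → ℕ) : shiftMul d g U (ν + d) = (U ν).map (mulMap n g) := by
  refine le_antisymm (iSup₂_le fun ν' h => ?_) (le_iSup₂_of_le ν rfl le_rfl)
  rw [add_right_cancel h]

theorem shiftMul_le {d : Fin q → ℕ} {g : Poly n A} {U : (Fin q → ℕ) → Submodule A M}
    {W : (Fin q → ℕ) → Submodule A M} (h : ∀ ν, ∀ m ∈ U ν, g • m ∈ W (ν + d))
    (μ : Fin q → ℕ) : shiftMul d g U μ ≤ W μ := by
  refine iSup₂_le fun ν e => ?_
  subst e
  rintro _ ⟨m, hm, rfl⟩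
  exact h ν m hm

theorem IsGradedSub.shiftMul (hℳ : IsGrading n ℳ) (hU : IsGradedSub n ℳ U) {d : Fin q → ℕ}
    {g : Poly n A} (hg : g ∈ polyComponent n A d) : IsGradedSub n ℳ (shiftMul d g U) where
  le := shiftMul_le fun ν m hm => hℳ.isGradedSub.smul_mem hg (hU.le ν hm)
  X_smul_mem v μ m hm := by
    have : Multigraded.shiftMul d g U μ ≤
        (Multigraded.shiftMul d g U (μ + varDegree n v)).comap (mulMap n (MvPolynomial.X v)) := by
      refine iSup₂_le fun ν e => ?_
      subst e
      rintro _ ⟨m, hm, rfl⟩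
      rw [Submodule.mem_comap, add_right_comm, shiftMul_add]
      refine ⟨_, hU.X_smul_mem v ν m hm, ?_⟩
      simp only [mulMap_apply, smul_smul, mul_comm]
    exact this hm

/-- The multigraded submodule with the given components. -/
noncomputable def IsGradedSub.toSubmodule (hU : IsGradedSub n ℳ U) : Submodule (Poly n A) M where
  toAddSubmonoid := (⨆ ν, U ν).toAddSubmonoid
  smul_mem' g m hm := by
    change g • m ∈ ⨆ ν, U ν
    change m ∈ ⨆ ν, U ν at hm
    induction g using MvPolynomial.induction_on generalizing m with
    | C a =>
      have : (MvPolynomial.C a : Poly n A) • m = a • m := algebraMap_smul (Poly n A) a m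
      rw [this]
      exact Submodule.smul_mem _ _ hm
    | add f g hf hg => rw [add_smul]; exact Submodule.add_mem _ (hf m hm) (hg m hm)
    | mul_X f v hf =>
      rw [mul_smul]
      refine hf _ ?_
      have : ⨆ ν, U ν ≤ (⨆ ν, U ν).comap (mulMap n (MvPolynomial.X v)) :=
        iSup_le fun ν m hm => Submodule.mem_iSup_of_mem _ (hU.X_smul_mem v ν m hm)
      exact this hm

theorem IsGradedSub.mem_toSubmodule (hU : IsGradedSub n ℳ U) {m : M} :
    m ∈ hU.toSubmodule ↔ m ∈ ⨆ ν, U ν := Iff.rfl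

theorem IsGradedSub.iSup_inf_eq (hℳ : IsGrading n ℳ) (hU : IsGradedSub n ℳ U) (ν : Fin q → ℕ) :
    (⨆ ν, U ν) ⊓ ℳ ν = U ν := by
  have h1 : ⨆ ν, U ν = U ν ⊔ ⨆ (μ) (_ : μ ≠ ν), U μ := by
    refine le_antisymm (iSup_le fun μ => ?_) (sup_le (le_iSup U ν) (iSup₂_le fun μ _ => le_iSup U μ))
    rcases eq_or_ne μ ν with rfl | h
    · exact le_sup_left
    · exact le_sup_of_le_right (le_iSup₂_of_le μ h le_rfl)
  have h2 : (⨆ (μ) (_ : μ ≠ ν), U μ) ⊓ ℳ ν = ⊥ := by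
    have h3 := hℳ.isInternal.submodule_iSupIndep ν
    exact (h3.mono_right (iSup₂_mono fun μ _ => hU.le μ)).symm.eq_bot
  rw [h1, sup_inf_assoc_of_le _ (hU.le ν), h2, sup_bot_eq]

theorem IsGradedSub.mem_toSubmodule_iff (hℳ : IsGrading n ℳ) (hU : IsGradedSub n ℳ U)
    {ν : Fin q → ℕ} {m : M} (hm : m ∈ ℳ ν) : m ∈ hU.toSubmodule ↔ m ∈ U ν := by
  rw [← hU.iSup_inf_eq hℳ ν, hU.mem_toSubmodule]
  exact ⟨fun h => ⟨h, hm⟩, fun h => h.1⟩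

theorem toSubmodule_le_iff (hℳ : IsGrading n ℳ) (hU : IsGradedSub n ℳ U)
    (hV : IsGradedSub n ℳ V) : hU.toSubmodule ≤ hV.toSubmodule ↔ U ≤ V := by
  refine ⟨fun h ν m hm => ?_, fun h m hm => ?_⟩
  · rw [← hV.mem_toSubmodule_iff hℳ (hU.le ν hm)]
    exact h ((hU.mem_toSubmodule_iff hℳ (hU.le ν hm)).2 hm)
  · exact hV.mem_toSubmodule.2 (iSup_mono h (hU.mem_toSubmodule.1 hm))

/-- The form in which Noetherianity of `M` over A[x] is used below. -/
theorem exists_maximal_gradedSub [IsNoetherianRing A] [Module.Finite (Poly n A) M]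
    (hℳ : IsGrading n ℳ) (C : Set ((Fin q → ℕ) → Submodule A M)) (hC : ∀ U ∈ C, IsGradedSub n ℳ U)
    (hne : C.Nonempty) : ∃ U ∈ C, ∀ V ∈ C, U ≤ V → V ≤ U := by
  obtain ⟨U₀, hU₀⟩ := hne
  have : IsNoetherian (Poly n A) M := inferInstance
  obtain ⟨_, ⟨U, rfl⟩, hmax⟩ := set_has_maximal_iff_noetherian.2 this
    (Set.range fun U : C => (hC U.1 U.2).toSubmodule) ⟨_, ⟨U₀, hU₀⟩, rfl⟩
  refine ⟨U.1, U.2, fun V hV hUV => ?_⟩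
  by_contra h
  refine hmax _ ⟨⟨V, hV⟩, rfl⟩ (lt_of_le_not_ge ?_ ?_)
  · exact (toSubmodule_le_iff hℳ _ _).2 hUV
  · exact fun h' => h ((toSubmodule_le_iff hℳ _ _).1 h')

/-- Adding to `V` the part of `U` with ν_p < k gives a graded submodule, since the x_{p,i} carry `U`
into `V`. This chain in `k` has a maximal member. -/
theorem exists_le_of_group_smul_mem [IsNoetherianRing A] [Module.Finite (Poly n A) M]
    (hℳ : IsGrading n ℳ) (hU : IsGradedSub n ℳ U) (hV : IsGradedSub n ℳ V) (p : Fin q)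
    (h : ∀ i ν, ∀ m ∈ U ν, (MvPolynomial.X ⟨p, i⟩ : Poly n A) • m ∈
      V (ν + varDegree n ⟨p, i⟩)) : ∃ k, ∀ ν : Fin q → ℕ, k ≤ ν p → U ν ≤ V ν := by
  have hW : ∀ k : ℕ, IsGradedSub n ℳ (fun ν => V ν ⊔ if ν p < k then U ν else ⊥) := by
    intro k
    refine ⟨fun ν => sup_le (hV.le ν) ?_, fun v ν m hm => ?_⟩
    · split_ifs
      exacts [hU.le ν, bot_le]
    · obtain ⟨a, ha, b, hb, rfl⟩ := Submodule.mem_sup.1 hm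
      rw [smul_add]
      refine Submodule.add_mem _ (Submodule.mem_sup_left (hV.X_smul_mem v ν a ha)) ?_
      split_ifs at hb with hk
      · obtain ⟨p', i⟩ := v
        rcases eq_or_ne p' p with rfl | hp
        · exact Submodule.mem_sup_left (h i ν b hb)
        · refine Submodule.mem_sup_right ?_
          rw [if_pos (by simpa [varDegree, hp.symm] using hk)]
          exact hU.X_smul_mem _ ν b hb
      · rw [(Submodule.mem_bot A).1 hb, smul_zero]
        exact Submodule.zero_mem _
  obtain ⟨_, ⟨k, rfl⟩, hk⟩ := exists_maximal_gradedSub hℳ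
    (Set.range fun (k : ℕ) (ν : Fin q → ℕ) => V ν ⊔ if ν p < k then U ν else ⊥)
    (by rintro _ ⟨k, rfl⟩; exact hW k) ⟨_, 0, rfl⟩
  refine ⟨k, fun ν hν => ?_⟩
  have := hk _ ⟨ν p + 1, rfl⟩ (fun μ => sup_le_sup_left (by
    split_ifs
    · exact le_rfl
    · omega
    · exact bot_le
    · exact le_rfl) _) ν
  simp only [Nat.lt_succ_self, if_true, if_neg (not_lt.2 hν), sup_bot_eq] at this
  exact le_sup_right.trans this

/-- A submodule `X` of the component extends to a graded submodule: `X` in degree ν, all of `M` in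
degrees strictly above ν, zero elsewhere. A maximal extension gives a maximal `X`. -/
theorem isNoetherian_component [IsNoetherianRing A] [Module.Finite (Poly n A) M]
    (hℳ : IsGrading n ℳ) (ν : Fin q → ℕ) : IsNoetherian A (ℳ ν) := by
  classical
  rw [← set_has_maximal_iff_noetherian]
  intro C hC
  let W : Submodule A (ℳ ν) → (Fin q → ℕ) → Submodule A M := fun X μ =>
    if μ = ν then X.map (ℳ ν).subtype else if ν ≤ μ then ℳ μ else ⊥
  have hW : ∀ X, IsGradedSub n ℳ (W X) := by
    intro X
    have hle : ∀ μ, W X μ ≤ ℳ μ := by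
      intro μ
      simp only [W]
      split_ifs with h1 h2
      · subst h1; exact Submodule.map_subtype_le _ _
      · exact le_rfl
      · exact bot_le
    refine ⟨hle, fun v μ m hm => ?_⟩
    by_cases hμ : ν ≤ μ
    · have h1 : μ + varDegree n v ≠ ν := by
        rintro rfl
        have := hμ v.1
        simp [varDegree] at this
      have h2 : W X (μ + varDegree n v) = ℳ (μ + varDegree n v) := by
        simp only [W, if_neg h1, if_pos (le_add_right hμ)]
      rw [h2]
      exact hℳ.isGradedSub.X_smul_mem v μ m (hle μ hm)
    · have h1 : μ ≠ ν := by rintro rfl; exact hμ le_rfl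
      simp only [W, if_neg h1, if_neg hμ, Submodule.mem_bot] at hm
      rw [hm, smul_zero]
      exact Submodule.zero_mem _
  obtain ⟨_, ⟨X, hX, rfl⟩, hmax⟩ := exists_maximal_gradedSub hℳ (W '' C)
    (by rintro _ ⟨X, _, rfl⟩; exact hW X) (hC.image W)
  refine ⟨X, hX, fun Y hY hlt => hlt.not_ge ?_⟩
  have := hmax (W Y) ⟨Y, hY, rfl⟩ (fun μ => by
    simp only [W]
    split_ifs
    · exact Submodule.map_mono hlt.le
    · exact le_rfl
    · exact le_rfl) ν
  simp only [W, if_true] at this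
  exact (Submodule.map_le_map_iff_of_injective (Submodule.subtype_injective _) _ _).1 this

theorem IsGradedSub.fg [IsNoetherianRing A] [Module.Finite (Poly n A) M]
    (hℳ : IsGrading n ℳ) (hU : IsGradedSub n ℳ U) (ν : Fin q → ℕ) : (U ν).FG := by
  have := isNoetherian_component hℳ ν
  have : IsNoetherian A (U ν) := isNoetherian_of_le (hU.le ν)
  exact Module.Finite.iff_fg.1 inferInstance

/-- The components of the submodule of `M` of the elements that are torsion modulo `V`. -/
def torsionClosure [IsDomain A] (ℳ V : (Fin q → ℕ) → Submodule A M) :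
    (Fin q → ℕ) → Submodule A M := fun ν =>
  { carrier := {m | m ∈ ℳ ν ∧ ∃ a : A, a ≠ 0 ∧ a • m ∈ V ν}
    add_mem' := by
      rintro x y ⟨hx, a, ha, hax⟩ ⟨hy, b, hb, hby⟩
      refine ⟨add_mem hx hy, a * b, mul_ne_zero ha hb, ?_⟩
      rw [smul_add]
      refine add_mem ?_ ?_
      · rw [mul_comm, mul_smul]; exact Submodule.smul_mem _ _ hax
      · rw [mul_smul]; exact Submodule.smul_mem _ _ hby
    zero_mem' := ⟨zero_mem _, 1, one_ne_zero, by simp⟩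
    smul_mem' := by
      rintro c x ⟨hx, a, ha, hax⟩
      refine ⟨Submodule.smul_mem _ _ hx, a, ha, ?_⟩
      rw [smul_comm]
      exact Submodule.smul_mem _ _ hax }

variable [IsDomain A]

theorem IsGradedSub.le_torsionClosure (hV : IsGradedSub n ℳ V) (ν : Fin q → ℕ) :
    V ν ≤ torsionClosure ℳ V ν := fun m hm => ⟨hV.le ν hm, 1, one_ne_zero, by simpa using hm⟩

theorem IsGradedSub.torsionClosure (hℳ : IsGrading n ℳ) (hV : IsGradedSub n ℳ V) :
    IsGradedSub n ℳ (torsionClosure ℳ V) where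
  le _ _ hm := hm.1
  X_smul_mem := by
    rintro v ν m ⟨hm, a, ha, ham⟩
    refine ⟨hℳ.isGradedSub.X_smul_mem v ν m hm, a, ha, ?_⟩
    rw [← smul_smul_A_comm]
    exact hV.X_smul_mem v ν _ ham

theorem mem_torsionClosure_of_smul_mem {ν : Fin q → ℕ} {m : M} {a : A} (ha : a ≠ 0)
    (hm : m ∈ ℳ ν) (h : a • m ∈ torsionClosure ℳ V ν) : m ∈ torsionClosure ℳ V ν := by
  obtain ⟨_, b, hb, h⟩ := h
  exact ⟨hm, b * a, mul_ne_zero hb ha, by rwa [mul_smul]⟩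

/-- The graded submodules {m | a m ∈ V}, a ≠ 0, form a family directed by divisibility, so a maximal
one contains all the others. The multiplier is therefore uniform in ν. -/
theorem exists_smul_torsionClosure_mem [IsNoetherianRing A] [Module.Finite (Poly n A) M]
    (hℳ : IsGrading n ℳ) (hV : IsGradedSub n ℳ V) :
    ∃ c : A, c ≠ 0 ∧ ∀ ν, ∀ m ∈ torsionClosure ℳ V ν, c • m ∈ V ν := by
  let W : A → (Fin q → ℕ) → Submodule A M := fun a ν =>
    ℳ ν ⊓ (V ν).comap (LinearMap.lsmul A M a)
  have hW : ∀ a, IsGradedSub n ℳ (W a) := by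
    refine fun a => ⟨fun ν => inf_le_left, fun v ν m hm => ⟨?_, ?_⟩⟩
    · exact hℳ.isGradedSub.X_smul_mem v ν m hm.1
    · change a • (MvPolynomial.X v : Poly n A) • m ∈ V _
      rw [← smul_smul_A_comm]
      exact hV.X_smul_mem v ν _ hm.2
  have hmono : ∀ a b, W a ≤ W (b * a) := fun a b ν m hm =>
    ⟨hm.1, by
      change (b * a) • m ∈ V ν
      rw [mul_smul]; exact Submodule.smul_mem _ _ hm.2⟩
  obtain ⟨_, ⟨c, hc, rfl⟩, hmax⟩ := exists_maximal_gradedSub hℳ (W '' {a | a ≠ 0})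
    (by rintro _ ⟨a, _, rfl⟩; exact hW a) ⟨_, 1, one_ne_zero, rfl⟩
  refine ⟨c, hc, fun ν m hm => ?_⟩
  obtain ⟨hm, a, ha, ham⟩ := hm
  have h1 : m ∈ W (c * a) ν := hmono a c ν ⟨hm, ham⟩
  rw [mul_comm] at h1
  exact (hmax (W (a * c)) ⟨a * c, mul_ne_zero ha hc, rfl⟩ (hmono c a) ν h1).2

end GradedSubmodules

/-! ### The multigraded Hilbert–Serre theorem -/

section HilbertFunction

variable {q : ℕ} {n : Fin q → ℕ} {A : Type*} [CommRing A] {M : Type*} [AddCommGroup M]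
  [Module A M] [Module (Poly n A) M] [IsScalarTower A (Poly n A) M]
  {ℳ U V W : (Fin q → ℕ) → Submodule A M} {S : Submonoid A}

/-- The Hilbert function of `U / V` with respect to the length after localization at `S`. -/
noncomputable def hilb (S : Submonoid A) (V U : (Fin q → ℕ) → Submodule A M) :
    (Fin q → ℕ) → ℚ := fun ν => ((relLen S (V ν) (U ν)).toNat : ℚ)

theorem toNat_cast_add {a b c : ℕ∞} (ha : a ≠ ⊤) (h : a = b + c) :
    (a.toNat : ℚ) = b.toNat + c.toNat := by
  subst h
  rw [ENat.toNat_add (by rintro rfl; simp at ha) (by rintro rfl; simp at ha), Nat.cast_add]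

theorem hilb_add {ν : Fin q → ℕ} (h1 : V ν ≤ W ν) (h2 : W ν ≤ U ν)
    (hfin : relLen S (V ν) (U ν) ≠ ⊤) : hilb S V U ν = hilb S V W ν + hilb S W U ν :=
  toNat_cast_add hfin (relLen_add h1 h2)

theorem ne_top_of_le {a b : ℕ∞} (h : a ≤ b) (hb : b ≠ ⊤) : a ≠ ⊤ := fun e =>
  hb (top_le_iff.1 (e ▸ h))

/-- Induction on the set `T` of variables that may act nontrivially on U/V. Kernel and cokernel of a
variable in `T` are killed by it, and they determine the difference in its direction. -/
theorem exists_evPol_hilb_of_smul_mem [IsNoetherianRing A] [Module.Finite (Poly n A) M]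
    (hℳ : IsGrading n ℳ) (T : Finset (Vars n)) : ∀ (V U : (Fin q → ℕ) → Submodule A M),
    IsGradedSub n ℳ V → IsGradedSub n ℳ U → (∀ ν, V ν ≤ U ν) →
    (∀ ν, relLen S (V ν) (U ν) ≠ ⊤) →
    (∀ v ∉ T, ∀ ν, ∀ m ∈ U ν, (MvPolynomial.X v : Poly n A) • m ∈ V (ν + varDegree n v)) →
    ∃ k, EvPol k (hilb S V U) := by
  classical
  induction T using Finset.strongInduction with
  | H T ih =>
    intro V U hV hU hVU hfin hT
    -- If a whole group of variables acts as zero, U/V vanishes for ν_p large. Otherwise each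
    -- direction has a variable in `T` to take differences with.
    by_cases hp : ∃ p, ∀ i, (⟨p, i⟩ : Vars n) ∉ T
    · obtain ⟨p, hp⟩ := hp
      obtain ⟨k, hk⟩ := exists_le_of_group_smul_mem hℳ hU hV p fun i => hT _ (hp i)
      refine ⟨0, ?_⟩
      change ∀ᶠ ν in atTop, _
      filter_upwards [eventually_ge_atTop (Pi.single p k)] with ν hν
      rw [hilb, relLen_of_le (hk ν (by simpa using hν p))]
      simp
    push Not at hp
    choose i hi using hp
    have key : ∀ p, ∃ k, EvPol k (diff p (hilb S V U)) := by
      intro p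
      set v : Vars n := ⟨p, i p⟩
      set x : Poly n A := MvPolynomial.X v
      set e : Fin q → ℕ := Pi.single p 1
      have hx : x ∈ polyComponent n A e := MvPolynomial.isWeightedHomogeneous_X A (varDegree n) v
      -- K/V and U/C are the kernel and the cokernel of `x` on U/V.
      let K : (Fin q → ℕ) → Submodule A M := fun ν => U ν ⊓ (V (ν + e)).comap (mulMap n x)
      let C : (Fin q → ℕ) → Submodule A M := fun ν => V ν ⊔ shiftMul e x U ν
      have hxU : ∀ ν, shiftMul e x U ν ≤ U ν := shiftMul_le fun ν m hm => hU.smul_mem hx hm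
      have hK : IsGradedSub n ℳ K := by
        refine ⟨fun ν => inf_le_left.trans (hU.le ν), fun w ν m hm => ⟨hU.X_smul_mem w ν m hm.1, ?_⟩⟩
        change x • (MvPolynomial.X w : Poly n A) • m ∈ V (ν + varDegree n w + e)
        rw [smul_smul, mul_comm, mul_smul, add_right_comm]
        exact hV.X_smul_mem w _ _ hm.2
      have hC : IsGradedSub n ℳ C := hV.sup (hU.shiftMul hℳ hx)
      have hVK : ∀ ν, V ν ≤ K ν := fun ν m hm => ⟨hVU ν hm, hV.smul_mem hx hm⟩
      have hKU : ∀ ν, K ν ≤ U ν := fun ν => inf_le_left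
      have hVC : ∀ ν, V ν ≤ C ν := fun ν => le_sup_left
      have hCU : ∀ ν, C ν ≤ U ν := fun ν => sup_le (hVU ν) (hxU ν)
      obtain ⟨k₁, hk₁⟩ := ih (T.erase v) (Finset.erase_ssubset (hi p)) V K hV hK hVK
        (fun ν => ne_top_of_le (relLen_mono (hKU ν)) (hfin ν)) (by
          intro w hw ν m hm
          rcases eq_or_ne w v with rfl | hne
          · exact hm.2
          · exact hT w (fun h => hw (Finset.mem_erase.2 ⟨hne, h⟩)) ν m hm.1)
      obtain ⟨k₂, hk₂⟩ := ih (T.erase v) (Finset.erase_ssubset (hi p)) C U hC hU hCU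
        (fun ν => ne_top_of_le (relLen_mono_left (hVC ν)) (hfin ν)) (by
          intro w hw ν m hm
          rcases eq_or_ne w v with rfl | hne
          · refine Submodule.mem_sup_right ?_
            change _ ∈ shiftMul e x U (ν + e)
            rw [shiftMul_add]
            exact ⟨m, hm, rfl⟩
          · exact Submodule.mem_sup_left
              (hT w (fun h => hw (Finset.mem_erase.2 ⟨hne, h⟩)) ν m hm))
      refine ⟨k₁ + k₂, (((hk₂.shift e).mono (by omega)).sub (hk₁.mono (by omega))).congr
        (.of_forall fun ν => ?_)⟩
      have h1 := hilb_add (hVK ν) (hKU ν) (hfin ν)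
      have h2 := hilb_add (hVC (ν + e)) (hCU (ν + e)) (hfin (ν + e))
      have h3 : hilb S V C (ν + e) = hilb S K U ν := by
        simp only [hilb, C]
        rw [relLen_sup, shiftMul_add, relLen_map (X := K ν)]
        exact fun y hy => ⟨fun h => h.2, fun h => ⟨hy, h⟩⟩
      simp only [diff]
      linarith
    choose k hk using key
    exact ⟨∑ p, k p + 1, fun p => (hk p).mono
      (Finset.single_le_sum (fun _ _ => Nat.zero_le _) (Finset.mem_univ p))⟩

/-- The Hilbert function of a multigraded module is eventually polynomial. -/
theorem exists_evPol_hilb [IsNoetherianRing A] [Module.Finite (Poly n A) M]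
    (hℳ : IsGrading n ℳ) (hV : IsGradedSub n ℳ V) (hU : IsGradedSub n ℳ U)
    (hVU : ∀ ν, V ν ≤ U ν) (hfin : ∀ ν, relLen S (V ν) (U ν) ≠ ⊤) : ∃ k, EvPol k (hilb S V U) :=
  exists_evPol_hilb_of_smul_mem hℳ Finset.univ V U hV hU hVU hfin
    fun v hv => absurd (Finset.mem_univ v) hv

end HilbertFunction

/-! ### How rank and torsion change modulo a filter-regular element -/

section DimensionDrop

variable {A : Type*} [CommRing A] [IsDomain A] [IsNoetherianRing A]

theorem relLen_nonZeroDivisors_ne_top {N : Type*} [AddCommGroup N] [Module A N]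
    {X Y : Submodule A N} (hY : Y.FG) : relLen (nonZeroDivisors A) X Y ≠ ⊤ := by
  have : Module.Finite A (Y.map X.mkQ) := Module.Finite.iff_fg.2 (hY.map _)
  rw [relLen, len_nonZeroDivisors]
  exact ENat.natCast_ne_top _

/-- By `h` the image of `Y` in N/X is torsion-free, so `len_quotient_smul_le` applies to it. -/
theorem relLen_sup_smul_le {p : PrimeSpectrum A} (hp : p.asIdeal.height = 1) {N : Type*}
    [AddCommGroup N] [Module A N] {X Y : Submodule A N} (hY : Y.FG)
    (h : ∀ y ∈ Y, ∀ a : A, a ≠ 0 → a • y ∈ X → y ∈ X) {c : A} (hc : c ≠ 0) :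
    relLen p.asIdeal.primeCompl (X ⊔ Y.map (LinearMap.lsmul A N c)) Y ≤
      relLen (nonZeroDivisors A) X Y * len p.asIdeal.primeCompl (A ⧸ Ideal.span {c}) := by
  set Q : Submodule A (N ⧸ X) := Y.map X.mkQ
  have : Module.Finite A Q := Module.Finite.iff_fg.2 (hY.map _)
  have : Module.IsTorsionFree A Q := by
    refine Module.IsTorsionFree.mk fun a ha => ?_
    have ha0 : a ≠ 0 := ha.ne_zero
    refine (injective_iff_map_eq_zero (LinearMap.lsmul A Q a)).2 ?_
    rintro ⟨_, y, hy, rfl⟩ e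
    have e1 : a • X.mkQ y = 0 := congrArg Subtype.val e
    rw [← map_smul] at e1
    exact Subtype.ext ((Submodule.Quotient.mk_eq_zero _).2
      (h y hy a ha0 ((Submodule.Quotient.mk_eq_zero _).1 e1)))
  have h1 := len_quotient_smul_le hp Q hc
  have h2 : relLen (nonZeroDivisors A) X Y = Module.finrank A Q := len_nonZeroDivisors Q
  rw [h2]
  refine le_of_eq_of_le ?_ h1
  have h3 := relLen_map (S := p.asIdeal.primeCompl) Q.subtype
    (X := (⊤ : Submodule A Q).map (LinearMap.lsmul A Q c))
    (X' := Q.map (LinearMap.lsmul A _ c)) (Y := ⊤) (by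
      rintro ⟨y, hy⟩ -
      constructor
      · rintro ⟨z, -, e⟩
        exact ⟨z.1, z.2, congrArg Subtype.val e⟩
      · rintro ⟨z, hz, e⟩
        exact ⟨⟨z, hz⟩, trivial, Subtype.ext e⟩)
  rw [← h3, Submodule.map_top, Submodule.range_subtype]
  refine (relLen_map X.mkQ fun y _ => ?_).symm
  constructor
  · intro hy
    obtain ⟨x, hx, _, ⟨z, hz, rfl⟩, rfl⟩ := Submodule.mem_sup.1 hy
    refine ⟨X.mkQ z, ⟨z, hz, rfl⟩, ?_⟩
    have : X.mkQ x = 0 := (Submodule.Quotient.mk_eq_zero X).2 hx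
    rw [map_add, this, zero_add]
    rfl
  · rintro ⟨_, ⟨z, hz, rfl⟩, e⟩
    have e : X.mkQ (c • z) = X.mkQ y := e
    have e : y - c • z ∈ X := (Submodule.Quotient.eq _).1 e.symm
    rw [← sub_add_cancel y (c • z)]
    exact Submodule.add_mem_sup e ⟨z, hz, rfl⟩

variable {q : ℕ} {n : Fin q → ℕ} {M : Type*} [AddCommGroup M]
  [Module A M] [Module (Poly n A) M] [IsScalarTower A (Poly n A) M]
  {ℳ U V : (Fin q → ℕ) → Submodule A M}

/-- The generic rank of `ℳ / V` has degree `< k`, and at each prime of height one the length of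
its torsion has degree `≤ k`. -/
def DimLT (ℳ V : (Fin q → ℕ) → Submodule A M) (k : ℕ) : Prop :=
  EvPol k (hilb (nonZeroDivisors A) V ℳ) ∧ ∀ p : PrimeSpectrum A, p.asIdeal.height = 1 →
    EvPol (k + 1) (hilb p.asIdeal.primeCompl V (torsionClosure ℳ V))

variable [Module.Finite (Poly n A) M]

theorem relLen_torsionClosure_ne_top (hℳ : IsGrading n ℳ) (hV : IsGradedSub n ℳ V)
    {p : PrimeSpectrum A} (hp : p.asIdeal.height = 1) (ν : Fin q → ℕ) :
    relLen p.asIdeal.primeCompl (V ν) (torsionClosure ℳ V ν) ≠ ⊤ :=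
  relLen_ne_top hp ((hV.torsionClosure hℳ).fg hℳ ν) fun _ hy => hy.2

/-! ### The dimension drop for one element -/

section Step

variable {d : Fin q → ℕ} {f : Poly n A}

/-- Additivity of rank along 0 → M/V → M/V → M/(V + fM) → 0, exact in these degrees, with the first
map multiplication by `f`. -/
theorem hilb_generic_sup_shiftMul (hℳ : IsGrading n ℳ) (hV : IsGradedSub n ℳ V)
    (hf : f ∈ polyComponent n A d) {ν : Fin q → ℕ}
    (hν : ∀ m ∈ ℳ ν, f • m ∈ V (ν + d) → m ∈ V ν) :
    hilb (nonZeroDivisors A) (fun ν => V ν ⊔ shiftMul d f ℳ ν) ℳ (ν + d) =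
      hilb (nonZeroDivisors A) V ℳ (ν + d) - hilb (nonZeroDivisors A) V ℳ ν := by
  have h1 := hilb_add (S := nonZeroDivisors A) (V := V) (W := fun ν => V ν ⊔ shiftMul d f ℳ ν)
    (U := ℳ) (ν := ν + d) le_sup_left
    ((hV.sup (hℳ.isGradedSub.shiftMul hℳ hf)).le _)
    (relLen_nonZeroDivisors_ne_top (hℳ.isGradedSub.fg hℳ _))
  have h2 : hilb (nonZeroDivisors A) V (fun ν => V ν ⊔ shiftMul d f ℳ ν) (ν + d) =
      hilb (nonZeroDivisors A) V ℳ ν := by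
    simp only [hilb]
    rw [relLen_sup, shiftMul_add, relLen_map (X := V ν)]
    exact fun y hy => ⟨fun h => hV.smul_mem hf h, hν y hy⟩
  linarith

/-- By `hG`, G ∩ (V + fM) = V + fG in degree ν + d, so the quotient is G/(V + fG), the cokernel of
the injective multiplication by `f` on G/V. -/
theorem hilb_sup_shiftMul_torsion (hℳ : IsGrading n ℳ) (hV : IsGradedSub n ℳ V)
    (hf : f ∈ polyComponent n A d) {ν : Fin q → ℕ} {p : PrimeSpectrum A}
    (hp : p.asIdeal.height = 1) (hν : ∀ m ∈ ℳ ν, f • m ∈ V (ν + d) → m ∈ V ν)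
    (hG : ∀ m ∈ ℳ ν, f • m ∈ torsionClosure ℳ V (ν + d) → m ∈ torsionClosure ℳ V ν) :
    hilb p.asIdeal.primeCompl (fun ν => V ν ⊔ shiftMul d f ℳ ν)
        (fun ν => torsionClosure ℳ V ν ⊔ shiftMul d f ℳ ν) (ν + d) =
      hilb p.asIdeal.primeCompl V (torsionClosure ℳ V) (ν + d) -
        hilb p.asIdeal.primeCompl V (torsionClosure ℳ V) ν := by
  set G := torsionClosure ℳ V with hGdef
  have hGg : IsGradedSub n ℳ G := hV.torsionClosure hℳ
  have h1 := hilb_add (S := p.asIdeal.primeCompl) (V := V) (W := fun ν => V ν ⊔ shiftMul d f G ν)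
    (U := G) (ν := ν + d) le_sup_left
    (sup_le (hV.le_torsionClosure _) (shiftMul_le (fun ν m hm => hGg.smul_mem hf hm) _))
    (relLen_torsionClosure_ne_top hℳ hV hp _)
  have h2 : hilb p.asIdeal.primeCompl V (fun ν => V ν ⊔ shiftMul d f G ν) (ν + d) =
      hilb p.asIdeal.primeCompl V G ν := by
    simp only [hilb]
    rw [relLen_sup, shiftMul_add, relLen_map (X := V ν)]
    exact fun y hy => ⟨fun h => hV.smul_mem hf h, hν y hy.1⟩
  have h3 : hilb p.asIdeal.primeCompl (fun ν => V ν ⊔ shiftMul d f ℳ ν)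
      (fun ν => G ν ⊔ shiftMul d f ℳ ν) (ν + d) =
      hilb p.asIdeal.primeCompl (fun ν => V ν ⊔ shiftMul d f G ν) G (ν + d) := by
    simp only [hilb]
    have e : G (ν + d) ⊔ shiftMul d f ℳ (ν + d) =
        (V (ν + d) ⊔ shiftMul d f ℳ (ν + d)) ⊔ G (ν + d) := by
      rw [sup_right_comm, sup_eq_right.2 (hV.le_torsionClosure _)]
    rw [e, relLen_sup, relLen_congr (X' := V (ν + d) ⊔ shiftMul d f G (ν + d))]
    intro y hy
    rw [shiftMul_add, shiftMul_add]
    constructor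
    · intro h
      obtain ⟨v, hv, _, ⟨m, hm, rfl⟩, rfl⟩ := Submodule.mem_sup.1 h
      refine Submodule.add_mem_sup hv ⟨m, hG m hm ?_, rfl⟩
      have := Submodule.sub_mem _ hy (hV.le_torsionClosure _ hv)
      simpa using this
    · have h4 : V (ν + d) ⊔ (G ν).map (mulMap n f) ≤ V (ν + d) ⊔ (ℳ ν).map (mulMap n f) :=
        sup_le_sup_left (Submodule.map_mono (hGg.le ν)) _
      exact fun h => h4 h
  linarith

/-- Multiplication by `c` embeds G'/(G + fM) into (G + fM)/(G + cfM), because M/G is torsion-free.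
Dividing by `f`, regular on M/G by `hG`, turns the target into M/(G + cM). -/
theorem relLen_torsion_sup_shiftMul_le (hℳ : IsGrading n ℳ) (hV : IsGradedSub n ℳ V)
    (hf : f ∈ polyComponent n A d) {ν : Fin q → ℕ} {p : PrimeSpectrum A}
    (hp : p.asIdeal.height = 1)
    (hG : ∀ m ∈ ℳ ν, f • m ∈ torsionClosure ℳ V (ν + d) → m ∈ torsionClosure ℳ V ν)
    {c : A} (hc : c ≠ 0)
    (hcV : ∀ ν, ∀ m ∈ torsionClosure ℳ (fun ν => V ν ⊔ shiftMul d f ℳ ν) ν,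
      c • m ∈ V ν ⊔ shiftMul d f ℳ ν) :
    relLen p.asIdeal.primeCompl (torsionClosure ℳ V (ν + d) ⊔ shiftMul d f ℳ (ν + d))
        (torsionClosure ℳ (fun ν => V ν ⊔ shiftMul d f ℳ ν) (ν + d)) ≤
      relLen (nonZeroDivisors A) (V ν) (ℳ ν) * len p.asIdeal.primeCompl (A ⧸ Ideal.span {c}) := by
  have hGg : IsGradedSub n ℳ (torsionClosure ℳ V) := hV.torsionClosure hℳ
  set G := torsionClosure ℳ V with hGdef
  set G' := torsionClosure ℳ (fun ν => V ν ⊔ shiftMul d f ℳ ν)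
  set S := p.asIdeal.primeCompl
  set X : Submodule A M := G (ν + d) ⊔ ((ℳ ν).map (mulMap n f)).map (LinearMap.lsmul A M c)
  have hfℳ : ∀ m ∈ ℳ ν, f • m ∈ ℳ (ν + d) := fun m hm => hℳ.isGradedSub.smul_mem hf hm
  calc relLen S (G (ν + d) ⊔ shiftMul d f ℳ (ν + d)) (G' (ν + d))
      = relLen S X ((G' (ν + d)).map (LinearMap.lsmul A M c)) := by
        refine (relLen_map _ fun y hy => ?_).symm
        rw [shiftMul_add]
        constructor
        · intro h
          obtain ⟨g, hg, _, ⟨m, hm, rfl⟩, rfl⟩ := Submodule.mem_sup.1 h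
          rw [map_add]
          exact Submodule.add_mem_sup (Submodule.smul_mem _ c hg) ⟨_, ⟨m, hm, rfl⟩, rfl⟩
        · intro h
          obtain ⟨g, hg, _, ⟨_, ⟨m, hm, rfl⟩, rfl⟩, e⟩ := Submodule.mem_sup.1 h
          have e : g + c • f • m = c • y := e
          have h1 : c • (y - f • m) ∈ G (ν + d) := by
            rw [smul_sub, ← e, add_sub_cancel_right]; exact hg
          have h2 := mem_torsionClosure_of_smul_mem hc (Submodule.sub_mem _ hy.1 (hfℳ m hm)) h1
          rw [← sub_add_cancel y (f • m)]
          exact Submodule.add_mem_sup h2 ⟨m, hm, rfl⟩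
    _ ≤ relLen S X (X ⊔ (ℳ ν).map (mulMap n f)) := by
        refine relLen_mono ?_
        rintro _ ⟨y, hy, rfl⟩
        have := hcV (ν + d) y hy
        rw [shiftMul_add] at this
        exact sup_le_sup_right ((hV.le_torsionClosure _).trans le_sup_left) _ this
    _ = relLen S (G ν ⊔ (ℳ ν).map (LinearMap.lsmul A M c)) (ℳ ν) := by
        rw [relLen_sup]
        refine relLen_map _ fun m hm => ?_
        constructor
        · intro h
          obtain ⟨g, hg, _, ⟨m', hm', rfl⟩, rfl⟩ := Submodule.mem_sup.1 h
          rw [map_add]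
          refine Submodule.add_mem_sup (hGg.smul_mem hf hg) ⟨_, ⟨m', hm', rfl⟩, ?_⟩
          exact (smul_smul_A_comm c f m').symm
        · intro h
          obtain ⟨g, hg, _, ⟨_, ⟨m', hm', rfl⟩, rfl⟩, e⟩ := Submodule.mem_sup.1 h
          have e : g + c • f • m' = f • m := e
          have h1 : f • (m - c • m') ∈ G (ν + d) := by
            rw [smul_sub, smul_smul_A_comm, ← e, add_sub_cancel_right]; exact hg
          have h2 := hG _ (Submodule.sub_mem _ hm (Submodule.smul_mem _ c hm')) h1
          rw [← sub_add_cancel m (c • m')]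
          exact Submodule.add_mem_sup h2 ⟨m', hm', rfl⟩
    _ ≤ relLen (nonZeroDivisors A) (G ν) (ℳ ν) * len S (A ⧸ Ideal.span {c}) :=
        relLen_sup_smul_le hp (hℳ.isGradedSub.fg hℳ ν)
          (fun y hy a ha h => mem_torsionClosure_of_smul_mem ha hy h) hc
    _ ≤ _ := by
        gcongr
        exact relLen_mono_left (hV.le_torsionClosure ν)

/-- A filter-regular element lowers the dimension. -/
theorem DimLT.sup_shiftMul (hℳ : IsGrading n ℳ) (hV : IsGradedSub n ℳ V)
    (hf : f ∈ polyComponent n A d) {k : ℕ} (h : DimLT ℳ V (k + 1))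
    (hreg : ∀ᶠ ν in atTop, ∀ m ∈ ℳ ν, f • m ∈ V (ν + d) → m ∈ V ν) :
    DimLT ℳ (fun ν => V ν ⊔ shiftMul d f ℳ ν) k := by
  -- Regularity passes from M/V to M/G: clear the torsion with `a`, then cancel `f`.
  have hregG : ∀ ν, (∀ m ∈ ℳ ν, f • m ∈ V (ν + d) → m ∈ V ν) →
      ∀ m ∈ ℳ ν, f • m ∈ torsionClosure ℳ V (ν + d) → m ∈ torsionClosure ℳ V ν := by
    rintro ν hν m hm ⟨_, a, ha, h⟩
    refine ⟨hm, a, ha, hν _ (Submodule.smul_mem _ a hm) ?_⟩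
    rwa [smul_smul_A_comm]
  have hV' := hV.sup (hℳ.isGradedSub.shiftMul hℳ hf)
  refine ⟨EvPol.of_shift d ((h.1.shift_sub d).congr ?_), fun p hp => ?_⟩
  · filter_upwards [hreg] with ν hν
    exact (hilb_generic_sup_shiftMul hℳ hV hf hν).symm
  have hB := (hV.torsionClosure hℳ).sup (hℳ.isGradedSub.shiftMul hℳ hf)
  have hV'B : ∀ ν, V ν ⊔ shiftMul d f ℳ ν ≤ torsionClosure ℳ V ν ⊔ shiftMul d f ℳ ν :=
    fun ν => sup_le_sup_right (hV.le_torsionClosure ν) _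
  have hBG' : ∀ ν, torsionClosure ℳ V ν ⊔ shiftMul d f ℳ ν ≤
      torsionClosure ℳ (fun ν => V ν ⊔ shiftMul d f ℳ ν) ν := by
    refine fun ν => sup_le ?_ (le_sup_right.trans (hV'.le_torsionClosure ν))
    rintro m ⟨hm, a, ha, ham⟩
    exact ⟨hm, a, ha, Submodule.mem_sup_left ham⟩
  have hfin := relLen_torsionClosure_ne_top hℳ hV' hp
  -- The part inherited from the torsion of M/V.
  have h1 : EvPol (k + 1) (hilb p.asIdeal.primeCompl (fun ν => V ν ⊔ shiftMul d f ℳ ν)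
      (fun ν => torsionClosure ℳ V ν ⊔ shiftMul d f ℳ ν)) := by
    refine EvPol.of_shift d (((h.2 p hp).shift_sub d).congr ?_)
    filter_upwards [hreg] with ν hν
    exact (hilb_sup_shiftMul_torsion hℳ hV hf hp hν (hregG ν hν)).symm
  have h2 : EvPol (k + 1) (hilb p.asIdeal.primeCompl
      (fun ν => torsionClosure ℳ V ν ⊔ shiftMul d f ℳ ν)
      (torsionClosure ℳ (fun ν => V ν ⊔ shiftMul d f ℳ ν))) := by
    -- New torsion: `c` is the same in every degree, so ℓ(A_p/c) is a constant and the bound grows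
    -- no faster than the rank of M/V.
    obtain ⟨c, hc, hcV⟩ := exists_smul_torsionClosure_mem hℳ hV'
    obtain ⟨l, hl⟩ := exists_evPol_hilb (S := p.asIdeal.primeCompl) hℳ hB (hV'.torsionClosure hℳ)
      hBG' fun ν => ne_top_of_le (relLen_mono_left (hV'B ν)) (hfin ν)
    refine EvPol.of_shift d (EvPol.of_le (hl.shift d)
      (h.1.const_mul ((len p.asIdeal.primeCompl (A ⧸ Ideal.span {c})).toNat : ℚ))
      (.of_forall fun ν => Nat.cast_nonneg _) ?_)
    filter_upwards [hreg] with ν hν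
    have h3 := relLen_torsion_sup_shiftMul_le hℳ hV hf hp (hregG ν hν) hc hcV
    have h4 : len p.asIdeal.primeCompl (A ⧸ Ideal.span {c}) ≠ ⊤ :=
      len_ne_top_of_smul_eq_zero hp hc fun x => by
        obtain ⟨x, rfl⟩ := Submodule.Quotient.mk_surjective _ x
        rw [← Submodule.Quotient.mk_smul, Submodule.Quotient.mk_eq_zero]
        exact Ideal.mul_mem_right _ _ (Ideal.mem_span_singleton_self c)
    have h5 := relLen_nonZeroDivisors_ne_top (X := V ν) (hℳ.isGradedSub.fg hℳ ν)
    have h6 := ENat.toNat_le_toNat h3 (WithTop.mul_ne_top h5 h4)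
    rw [ENat.toNat_mul, mul_comm] at h6
    simp only [hilb]
    exact_mod_cast h6
  refine (h1.add h2).congr (.of_forall fun ν => ?_)
  exact (hilb_add (V := fun ν => V ν ⊔ shiftMul d f ℳ ν)
    (W := fun ν => torsionClosure ℳ V ν ⊔ shiftMul d f ℳ ν)
    (U := torsionClosure ℳ (fun ν => V ν ⊔ shiftMul d f ℳ ν)) (hV'B ν) (hBG' ν) (hfin ν)).symm

end Step

end DimensionDrop

/-! ### Induction along the filter-regular sequence -/

section FilterRegularSequences

variable {A : Type*} [CommRing A] [IsDomain A] [IsNoetherianRing A]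
  {q : ℕ} {n : Fin q → ℕ} {M : Type*} [AddCommGroup M]
  [Module A M] [Module (Poly n A) M] [IsScalarTower A (Poly n A) M]
  {ℳ U V : (Fin q → ℕ) → Submodule A M}

theorem relLen_bot {S : Submonoid A} (Y : Submodule A M) : relLen S ⊥ Y = len S Y :=
  (len_congr S (Submodule.equivMapOfInjective (⊥ : Submodule A M).mkQ
    (LinearMap.ker_eq_bot.1 (Submodule.ker_mkQ ⊥)) Y)).symm

theorem hilb_bot_eq_genericRank [Module.Finite (Poly n A) M] (hℳ : IsGrading n ℳ)
    (ν : Fin q → ℕ) :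
    hilb (nonZeroDivisors A) (fun _ => ⊥) ℳ ν = (genericRank A (ℳ ν) : ℚ) := by
  have := isNoetherian_component hℳ ν
  rw [hilb, relLen_bot, len_nonZeroDivisors, genericRank_eq, ENat.toNat_natCast]

theorem exists_isHilbertPolynomial [Module.Finite (Poly n A) M] (hℳ : IsGrading n ℳ) :
    ∃ P, IsHilbertPolynomial ℳ P := by
  obtain ⟨k, hk⟩ := exists_evPol_hilb (S := nonZeroDivisors A) hℳ isGradedSub_bot
    hℳ.isGradedSub (fun _ => bot_le)
    fun ν => relLen_nonZeroDivisors_ne_top (hℳ.isGradedSub.fg hℳ ν)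
  obtain ⟨P, hP⟩ := hk.exists_eval_eq
  obtain ⟨ν₀, h₀⟩ := eventually_atTop.1 hP
  exact ⟨P, ν₀, fun ν hν => by rw [← hilb_bot_eq_genericRank hℳ]; exact h₀ ν hν⟩

/-- `EvPol s` means degree < s, which matches s = r + 1. The convention r = -1 for a zero polynomial
gives s = 0. -/
theorem evPol_hilb_of_relevantDim [Module.Finite (Poly n A) M] (hℳ : IsGrading n ℳ)
    {s : ℕ} (hs : (s : ℤ) = relevantDim ℳ + 1) :
    EvPol s (hilb (nonZeroDivisors A) (fun _ => ⊥) ℳ) := by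
  have hex := exists_isHilbertPolynomial hℳ
  have hP : IsHilbertPolynomial ℳ (hilbertPolynomial ℳ) := by
    rw [hilbertPolynomial, dif_pos hex]
    exact hex.choose_spec
  obtain ⟨ν₀, h₀⟩ := hP
  have heq : ∀ᶠ ν in atTop, MvPolynomial.eval (fun p => (ν p : ℚ)) (hilbertPolynomial ℳ) =
      hilb (nonZeroDivisors A) (fun _ => ⊥) ℳ ν := by
    filter_upwards [eventually_ge_atTop ν₀] with ν hν
    rw [hilb_bot_eq_genericRank hℳ, h₀ ν hν]
  rw [relevantDim] at hs
  split_ifs at hs with h0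
  · obtain rfl : s = 0 := by omega
    rw [h0] at heq
    change ∀ᶠ ν in atTop, _
    filter_upwards [heq] with ν hν
    rw [← hν, map_zero]
  · obtain rfl : s = (hilbertPolynomial ℳ).totalDegree + 1 := by omega
    exact (evPol_eval _).congr heq

/-- Projectivity enters here: M is torsion-free, so the torsion part of the invariant is zero. -/
theorem dimLT_bot [Module.Finite (Poly n A) M] [Module.Projective A M] (hℳ : IsGrading n ℳ)
    {s : ℕ} (hs : (s : ℤ) = relevantDim ℳ + 1) : DimLT ℳ (fun _ => ⊥) s := by
  refine ⟨evPol_hilb_of_relevantDim hℳ hs, fun p hp => EvPol.mono (k := 0) ?_ (Nat.zero_le _)⟩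
  refine .of_forall fun ν => ?_
  have : torsionClosure ℳ (fun _ => ⊥) ν = ⊥ := by
    rw [eq_bot_iff]
    rintro m ⟨-, a, ha, h⟩
    have : Module.IsTorsionFree A M := inferInstance
    exact (smul_eq_zero.1 h).resolve_left ha
  rw [hilb, relLen_of_le this.le]
  simp

theorem iSup_shiftMul (hℳ : IsGrading n ℳ) (d : Fin q → ℕ) (f : Poly n A) :
    ⨆ μ, shiftMul d f ℳ μ = (⊤ : Submodule A M).map (mulMap n f) := by
  rw [← hℳ.isInternal.submodule_iSup_eq_top, Submodule.map_iSup]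
  refine le_antisymm (iSup_le fun μ => iSup₂_le fun ν _ => ?_) (iSup_le fun ν => ?_)
  · exact le_iSup (fun ν => (ℳ ν).map (mulMap n f)) ν
  · rw [← shiftMul_add]
    exact le_iSup (shiftMul d f ℳ) (ν + d)

theorem toSubmodule_sup_shiftMul (hℳ : IsGrading n ℳ) (hV : IsGradedSub n ℳ V)
    {d : Fin q → ℕ} {f : Poly n A} (hV' : IsGradedSub n ℳ (fun ν => V ν ⊔ shiftMul d f ℳ ν))
    {I : Ideal (Poly n A)} (h : hV.toSubmodule = I • ⊤) :
    hV'.toSubmodule = (I ⊔ Ideal.span {f}) • ⊤ := by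
  rw [Submodule.sup_smul, ← h, Submodule.ideal_span_singleton_smul]
  ext m
  rw [hV'.mem_toSubmodule, iSup_sup_eq, iSup_shiftMul hℳ, Submodule.mem_sup, Submodule.mem_sup]
  rfl

/-- The components of `(f_0, …, f_{i-1}) M`. -/
noncomputable def seqSub (ℳ : (Fin q → ℕ) → Submodule A M) {s : ℕ} (d : Fin s → Fin q → ℕ)
    (f : Fin s → Poly n A) : ℕ → (Fin q → ℕ) → Submodule A M
  | 0 => fun _ => ⊥
  | i + 1 => if h : i < s then
      fun ν => seqSub ℳ d f i ν ⊔ shiftMul (d ⟨i, h⟩) (f ⟨i, h⟩) ℳ ν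
    else seqSub ℳ d f i

variable {s : ℕ} {d : Fin s → Fin q → ℕ} {f : Fin s → Poly n A}

theorem seqSub_succ {i : ℕ} (h : i < s) : seqSub ℳ d f (i + 1) =
    fun ν => seqSub ℳ d f i ν ⊔ shiftMul (d ⟨i, h⟩) (f ⟨i, h⟩) ℳ ν := by
  rw [seqSub, dif_pos h]

theorem isGradedSub_seqSub (hℳ : IsGrading n ℳ) (hf : ∀ i, f i ∈ polyComponent n A (d i))
    (i : ℕ) : IsGradedSub n ℳ (seqSub ℳ d f i) := by
  induction i with
  | zero => exact isGradedSub_bot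
  | succ i ih =>
    rw [seqSub]
    split_ifs with h
    · exact ih.sup (hℳ.isGradedSub.shiftMul hℳ (hf _))
    · exact ih

/-- Identifies the degreewise construction with the submodules generated by initial segments of the
sequence. -/
theorem toSubmodule_seqSub (hℳ : IsGrading n ℳ) (hf : ∀ i, f i ∈ polyComponent n A (d i))
    (i : ℕ) (hi : i ≤ s) : (isGradedSub_seqSub hℳ hf i).toSubmodule =
      Ideal.span (f '' {j | j.1 < i}) • (⊤ : Submodule (Poly n A) M) := by
  induction i with
  | zero =>
    have h : {j : Fin s | j.1 < 0} = ∅ := by ext; simp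
    rw [h, Set.image_empty, Ideal.span_empty, Submodule.bot_smul, eq_bot_iff]
    intro m hm
    rw [IsGradedSub.mem_toSubmodule] at hm
    simpa [seqSub] using hm
  | succ i ih =>
    have h : {j : Fin s | j.1 < i + 1} = {j : Fin s | j.1 < i} ∪ {⟨i, hi⟩} := by
      ext j
      simp only [Set.mem_ofPred_eq, Set.mem_union, Set.mem_singleton_iff, Fin.ext_iff]
      omega
    rw [h, Set.image_union, Set.image_singleton, Ideal.span_union]
    have h1 := isGradedSub_seqSub hℳ hf i
    have h2 := isGradedSub_seqSub hℳ hf (i + 1)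
    have key : ∀ W (hW : IsGradedSub n ℳ W), W = (fun ν => seqSub ℳ d f i ν ⊔
        shiftMul (d ⟨i, hi⟩) (f ⟨i, hi⟩) ℳ ν) → hW.toSubmodule =
        (Ideal.span (f '' {j : Fin s | j.1 < i}) ⊔ Ideal.span {f ⟨i, hi⟩}) • ⊤ := by
      rintro _ hW rfl
      exact toSubmodule_sup_shiftMul hℳ h1 hW (ih (Nat.le_of_succ_le hi))
    exact key _ h2 (seqSub_succ hi)

theorem dimLT_seqSub [Module.Finite (Poly n A) M] (hℳ : IsGrading n ℳ)
    (hf : ∀ i, f i ∈ polyComponent n A (d i)) (hreg : IsFilterRegularSeq n ℳ f)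
    (h0 : DimLT ℳ (fun _ => ⊥) s) (i : ℕ) (hi : i ≤ s) : DimLT ℳ (seqSub ℳ d f i) (s - i) := by
  induction i with
  | zero => exact h0
  | succ i ih =>
    have ih := ih (Nat.le_of_succ_le hi)
    have e : s - i = s - (i + 1) + 1 := by omega
    have hg := isGradedSub_seqSub hℳ hf i
    rw [e] at ih
    rw [seqSub_succ hi]
    refine ih.sup_shiftMul hℳ hg (hf _) ?_
    obtain ⟨-, ν₀, h₀⟩ := hreg ⟨i, hi⟩
    filter_upwards [eventually_ge_atTop ν₀] with ν hν m hm hfm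
    have hts := toSubmodule_seqSub hℳ hf i (Nat.le_of_succ_le hi)
    have h1 := h₀ ν hν _ (Submodule.mem_map_of_mem hm) (by
      refine (Submodule.Quotient.mk_eq_zero _).2 (?_ : f ⟨i, hi⟩ • m ∈ _)
      exact hts.le ((hg.mem_toSubmodule_iff hℳ (hℳ.isGradedSub.smul_mem (hf _) hm)).2 hfm))
    have h2 : m ∈ Ideal.span (f '' {j : Fin s | j.1 < i}) • (⊤ : Submodule (Poly n A) M) :=
      (Submodule.Quotient.mk_eq_zero _).1 h1
    rw [← hts] at h2
    exact (hg.mem_toSubmodule_iff hℳ hm).1 h2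

theorem mem_ideal_smul_iff_mem_seqSub (hℳ : IsGrading n ℳ)
    (hf : ∀ i, f i ∈ polyComponent n A (d i)) {ν : Fin q → ℕ} {m : M} (hm : m ∈ ℳ ν) :
    m ∈ Ideal.span (Set.range f) • (⊤ : Submodule (Poly n A) M) ↔ m ∈ seqSub ℳ d f s ν := by
  rw [← (isGradedSub_seqSub hℳ hf s).mem_toSubmodule_iff hℳ hm,
    toSubmodule_seqSub hℳ hf s le_rfl]
  simp

theorem len_quotientComponent (hℳ : IsGrading n ℳ) (hf : ∀ i, f i ∈ polyComponent n A (d i))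
    (S : Submonoid A) (ν : Fin q → ℕ) :
    len S (quotientComponent n ℳ f ν) = relLen S (seqSub ℳ d f s ν) (ℳ ν) := by
  refine (len_map_eq_of_ker _ (seqSub ℳ d f s ν).mkQ LinearMap.id fun m hm => ?_).trans
    (by rw [Submodule.map_id]; rfl)
  rw [LinearMap.id_apply, Submodule.mkQ_apply, Submodule.Quotient.mk_eq_zero,
    ← mem_ideal_smul_iff_mem_seqSub hℳ hf hm]
  exact Submodule.Quotient.mk_eq_zero _

theorem smul_quotientComponent_eq_zero (hℳ : IsGrading n ℳ)
    (hf : ∀ i, f i ∈ polyComponent n A (d i)) {ν : Fin q → ℕ} {c : A}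
    (h : ∀ m ∈ ℳ ν, c • m ∈ seqSub ℳ d f s ν) (x : quotientComponent n ℳ f ν) : c • x = 0 := by
  obtain ⟨_, m, hm, rfl⟩ := x
  refine Subtype.ext ?_
  refine (Submodule.Quotient.mk_eq_zero _).2 (?_ : c • m ∈ _)
  exact (mem_ideal_smul_iff_mem_seqSub hℳ hf (Submodule.smul_mem _ c hm)).2 (h m hm)

end FilterRegularSequences

/-! ### Divisors of torsion modules -/

section Divisors

variable {A : Type*} [CommRing A] [IsDomain A] [IsNoetherianRing A]

theorem divisor_apply {N : Type*} [AddCommGroup N] [Module A N] (h : IsTorsionModule A N)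
    (p : HeightOnePrime A) : divisor A N p = ((localLength A N p.1).toNat : ℤ) := by
  rw [divisor, dif_pos h]
  rfl

theorem localLength_ne_top {N : Type*} [AddCommGroup N] [Module A N] (h : IsTorsionModule A N)
    (p : HeightOnePrime A) : localLength A N p.1 ≠ ⊤ := by
  obtain ⟨hfin, hann⟩ := h
  obtain ⟨c, hc, hc0⟩ := Submodule.exists_mem_ne_zero_of_ne_bot hann
  exact len_ne_top_of_smul_eq_zero p.2 hc0 fun x => Module.mem_annihilator.1 hc x

theorem divisor_ne_zero_iff {N : Type*} [AddCommGroup N] [Module A N] (h : IsTorsionModule A N) :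
    divisor A N ≠ 0 ↔ ∃ p : PrimeSpectrum A, p.asIdeal.height = 1 ∧
      Module.annihilator A N ≤ p.asIdeal := by
  rw [Finsupp.ne_iff]
  constructor
  · rintro ⟨p, hp⟩
    refine ⟨p.1, p.2, annihilator_le_of_localLength_ne_zero fun h0 => hp ?_⟩
    rw [divisor_apply h, h0]
    rfl
  · rintro ⟨p, hp, hle⟩
    refine ⟨⟨p, hp⟩, ?_⟩
    rw [divisor_apply h]
    have hfin := h.1
    have hmem : p ∈ Module.support A N := Module.mem_support_iff_of_finite.2 hle
    have hne : localLength A N p ≠ 0 := by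
      rw [Module.mem_support_iff] at hmem
      rw [localLength, Ne, Module.length_eq_zero_iff, not_subsingleton_iff_nontrivial]
      exact hmem
    -- `ENat.toNat` sends ⊤ to 0, so a nonzero coefficient needs the length to be finite as well as
    -- nonzero.
    have := localLength_ne_top h ⟨p, hp⟩
    simp only [Finsupp.coe_zero, Pi.zero_apply, Ne, Nat.cast_eq_zero, ENat.toNat_eq_zero, not_or]
    exact ⟨hne, this⟩

end Divisors

/-- The end of the induction, k = 0: rank eventually zero and torsion lengths of degree ≤ 0. -/
theorem eventually_torsion_and_localLength_const {A : Type*} [CommRing A] [IsDomain A]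
    [IsNoetherianRing A] {q : ℕ} {n : Fin q → ℕ} {M : Type*} [AddCommGroup M] [Module A M]
    [Module (Poly n A) M] [IsScalarTower A (Poly n A) M] [Module.Finite (Poly n A) M]
    [Module.Projective A M] {ℳ : (Fin q → ℕ) → Submodule A M} (hℳ : IsGrading n ℳ) {s : ℕ}
    (hs : (s : ℤ) = relevantDim ℳ + 1) {f : Fin s → Poly n A} (hf : IsFilterRegularSeq n ℳ f) :
    ∃ c : HeightOnePrime A → ℚ, ∀ᶠ ν in atTop, IsTorsionModule A (quotientComponent n ℳ f ν) ∧
      ∀ p : HeightOnePrime A,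
        ((localLength A (quotientComponent n ℳ f ν) p.1).toNat : ℚ) = c p := by
  choose d hd using fun i => (hf i).1
  set W := seqSub ℳ d f s with hW
  have hWg : IsGradedSub n ℳ W := isGradedSub_seqSub hℳ hd s
  have hdim : DimLT ℳ W (s - s) := dimLT_seqSub hℳ hd hf (dimLT_bot hℳ hs) s le_rfl
  rw [Nat.sub_self] at hdim
  obtain ⟨a, ha, haW⟩ := exists_smul_torsionClosure_mem hℳ hWg
  have htors : ∀ᶠ ν in atTop, torsionClosure ℳ W ν = ℳ ν := by
    have h1 : ∀ᶠ ν in atTop, hilb (nonZeroDivisors A) W ℳ ν = 0 := hdim.1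
    filter_upwards [h1] with ν hν
    refine le_antisymm (fun m hm => hm.1) fun m hm => ?_
    have h2 := relLen_nonZeroDivisors_ne_top (X := W ν) (hℳ.isGradedSub.fg hℳ ν)
    simp only [hilb, Nat.cast_eq_zero, ENat.toNat_eq_zero, h2, or_false] at hν
    obtain ⟨b, hb, h⟩ := relLen_eq_zero_iff.1 hν m hm
    exact ⟨hm, b, nonZeroDivisors.ne_zero hb, h⟩
  have hfinset := finite_heightOnePrime_of_ne_bot (I := Ideal.span {a})
    (by rwa [Ne, Ideal.span_singleton_eq_bot])
  have hconst : ∀ p : HeightOnePrime A, ∃ c : ℚ, ∀ᶠ ν in atTop,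
      hilb p.1.asIdeal.primeCompl W (torsionClosure ℳ W) ν = c := by
    intro p
    obtain ⟨ν₀, h₀⟩ := (hdim.2 p.1 p.2).eventually_const
    exact ⟨_, eventually_atTop.2 ⟨ν₀, h₀⟩⟩
  choose c hc using hconst
  classical
  -- Primes not containing `a` contribute 0 as soon as the component is torsion. Only the finitely
  -- many others need a threshold of their own.
  refine ⟨fun p => if Ideal.span {a} ≤ p.1.asIdeal then c p else 0, ?_⟩
  filter_upwards [htors, (eventually_all_finite hfinset).2 fun p _ => hc p] with ν h1 h2
  have hann : ∀ x : quotientComponent n ℳ f ν, a • x = 0 :=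
    smul_quotientComponent_eq_zero hℳ hd fun m hm => haW ν m (h1.ge hm)
  have hmem : a ∈ Module.annihilator A (quotientComponent n ℳ f ν) :=
    Module.mem_annihilator.2 hann
  refine ⟨⟨Module.Finite.iff_fg.2 ((hℳ.isGradedSub.fg hℳ ν).map _), fun e => ?_⟩, fun p => ?_⟩
  · rw [e] at hmem
    exact ha hmem
  · split_ifs with hp
    · rw [← h2 p hp, localLength_eq_len, len_quotientComponent hℳ hd, hilb, h1]
    · rw [Nat.cast_eq_zero, ENat.toNat_eq_zero]
      left
      by_contra h
      exact hp ((Ideal.span_singleton_le_iff_mem _).2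
        (annihilator_le_of_localLength_ne_zero h hmem))

end Multigraded

theorem mainTheorem5 {A : Type*} [CommRing A] [IsDomain A] [IsNoetherianRing A]
    {q : ℕ} (hq : 0 < q) (n : Fin q → ℕ) (hn : ∀ p, 0 < n p)
    {M : Type*} [AddCommGroup M] [Module A M] [Module (Multigraded.Poly n A) M]
    [IsScalarTower A (Multigraded.Poly n A) M]
    (ℳ : (Fin q → ℕ) → Submodule A M) (hℳ : Multigraded.IsGrading n ℳ)
    (hfin : Module.Finite (Multigraded.Poly n A) M) (hproj : Module.Projective A M)
    (r : ℤ) (hr : Multigraded.relevantDim ℳ = r)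
    (s : ℕ) (hs : (s : ℤ) = r + 1) (f : Fin s → Multigraded.Poly n A)
    (hf : Multigraded.IsFilterRegularSeq n ℳ f) :
    ∃ ν₀ : Fin q → ℕ, ∀ ν, ν₀ ≤ ν →
      Multigraded.IsTorsionModule A (Multigraded.quotientComponent n ℳ f ν) ∧
      Multigraded.divisor A (Multigraded.quotientComponent n ℳ f ν) =
        Multigraded.divisor A (Multigraded.quotientComponent n ℳ f ν₀) ∧
      (Multigraded.divisor A (Multigraded.quotientComponent n ℳ f ν) ≠ 0 ↔
        ∃ p : PrimeSpectrum A, p.asIdeal.height = 1 ∧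
          Module.annihilator A (Multigraded.quotientComponent n ℳ f ν) ≤ p.asIdeal) := by
  subst hr
  obtain ⟨c, hc⟩ := Multigraded.eventually_torsion_and_localLength_const hℳ hs hf
  obtain ⟨ν₀, h₀⟩ := Filter.eventually_atTop.1 hc
  refine ⟨ν₀, fun ν hν => ⟨(h₀ ν hν).1, ?_, Multigraded.divisor_ne_zero_iff (h₀ ν hν).1⟩⟩
  ext p
  rw [Multigraded.divisor_apply (h₀ ν hν).1, Multigraded.divisor_apply (h₀ ν₀ le_rfl).1]
  have := ((h₀ ν hν).2 p).trans ((h₀ ν₀ le_rfl).2 p).symm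
  exact_mod_cast this
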